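/- Let $\ell,k,r$ be integers with $1\le k<\ell$ and $r\ge 2$, and let $\mathcal M\subset\mathbb R^\ell$ be an embedded $k$-dimensional submanifold of class $C^r$. Let $\mathcal U\subset\mathbb R^\ell$ be open and $\phi:\mathcal U\to\mathcal M$ a map of class $C^{r-1}$ (a tubular projection) such that for all $x\in\mathcal U$ the vector $x-\phi(x)$ is orthogonal to $T_{\phi(x)}\mathcal M$, and $\epsilon x+(1-\epsilon)\phi(x)\in\mathcal U$ for all $\epsilon\in[0,1]$. For $x\in\mathcal U$ let $P(x)$ be the orthogonal projection of $\mathbb R^\ell$ onto the orthogonal complement of $T_{\phi(x)}\mathcal M$. Let $\Omega\subset\mathbb R^\ell$ be a nonempty bounded domain (open and connected) with $\overline\Omega\subset\mathcal U$; no regularity of $\partial\Omega$ is assumed. For $p\in\mathcal M$ put $\Omega_p=\{x\in\Omega:\phi(x)=p\}$ (the normal section), and for $\bar x\in\Omega_p$ let $\Omega_p(\bar x)$ be the connected component of $\Omega_p$ containing $\bar x$. Let $\mathcal H^m$ denote the $m$-dimensional Hausdorff measure on $\mathbb R^\ell$, and $\nabla$ the weak gradient. **Theorem 3.1.** Let $u\in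 L^2_{\rm loc}(\Omega)$, and suppose there are $u_m\in H^1_{\rm loc}(\Omega)$, $m\in\mathbb N$, with $P(x)\nabla u_m(x)=0$ for a.e. $x\in\Omega$ and $u_m\to u$ in $L^2_{\rm loc}(\Omega)$ as $m\to\infty$. Then there is a set $Z\subset\mathcal M$ with $\mathcal H^k(Z)=0$ and, for every $p\in\mathcal M\setminus Z$, a set $S_p\subset\phi^{-1}(p)$ with $\mathcal H^{\ell-k}(S_p)=0$, such that for all $p\in\mathcal M\setminus Z$ and all $\bar x\in\Omega_p$ there is a constant $v(p,\bar x)\in\mathbb R$ with $$u(x)=v(p,\bar x)\quad\text{for all }x\in\Omega_p(\bar x)\setminus S_p .$$ Moreover, the assumption on $u$ is satisfied whenever $u\in L^2_s(\Omega)$, where $L^2_s(\Omega)$ is the closure in $L^2(\Omega)$ of $H^1_s(\Omega)=\{w\in H^1(\Omega): P(x)\nabla w(x)=0 \text{ for a.e. } x\in\Omega\}$. -/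

import Mathlib

open MeasureTheory Filter Set
open scoped Topology ContDiff

noncomputable section

/-- `ℝ^ℓ` with the Euclidean norm. -/
abbrev Euc (l : ℕ) : Type := EuclideanSpace ℝ (Fin l)

/-- `M ⊆ ℝ^ℓ` is an embedded `k`-dimensional submanifold of class `C^r`: around each of its points
there is a `C^r` diffeomorphism between open sets of `ℝ^ℓ` and of `ℝ^k × ℝ^(ℓ-k)` that carries `M`
to the slice `ℝ^k × {0}`. -/
def IsEmbeddedSubmanifold {l : ℕ} (k r : ℕ) (M : Set (Euc l)) : Prop :=
  ∀ p ∈ M, ∃ Ψ : OpenPartialHomeomorph (Euc l) (Euc k × Euc (l - k)),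
    p ∈ Ψ.source ∧
    ContDiffOn ℝ (r : WithTop ℕ∞) Ψ Ψ.source ∧
    ContDiffOn ℝ (r : WithTop ℕ∞) Ψ.symm Ψ.target ∧
    ∀ x ∈ Ψ.source, x ∈ M ↔ (Ψ x).2 = 0

/-- The tangent space `T_p M ⊆ ℝ^ℓ`: the space of velocities at `p` of curves in `M` through `p`.
(For a submanifold the velocities already form a linear space; the span turns the
set into a bundled `Submodule`.) -/
def tangentAt {l : ℕ} (M : Set (Euc l)) (p : Euc l) : Submodule ℝ (Euc l) :=
  Submodule.span ℝ
    {v | ∃ γ : ℝ → Euc l, γ 0 = p ∧ (∀ᶠ t in 𝓝 (0 : ℝ), γ t ∈ M) ∧ HasDerivAt γ v 0}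

/-- `φ : U → M` is a tubular projection of class `C^s`: `U` is open, `x - φ x` is orthogonal to
`T_{φ x} M` for every `x ∈ U`, and `ε x + (1 - ε) φ x ∈ U` for all `x ∈ U`, `ε ∈ [0, 1]`. -/
structure IsTubularProjection {l : ℕ} (s : ℕ) (M U : Set (Euc l)) (φ : Euc l → Euc l) :
    Prop where
  isOpen : IsOpen U
  mapsTo : MapsTo φ U M
  contDiffOn : ContDiffOn ℝ (s : WithTop ℕ∞) φ U
  orthogonal : ∀ x ∈ U, x - φ x ∈ (tangentAt M (φ x))ᗮ
  segment : ∀ x ∈ U, ∀ ε ∈ Icc (0 : ℝ) 1, ε • x + (1 - ε) • φ x ∈ U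

/-- `P(x)`: the orthogonal projection of `ℝ^ℓ` onto the orthogonal complement of `T_{φ x} M`. -/
def normalProj {l : ℕ} (M : Set (Euc l)) (φ : Euc l → Euc l) (x : Euc l) : Euc l →L[ℝ] Euc l :=
  (tangentAt M (φ x))ᗮ.starProjection

/-- The normal section `Ω_p = {x ∈ Ω | φ x = p}`. -/
def normalSection {l : ℕ} (φ : Euc l → Euc l) (Ω : Set (Euc l)) (p : Euc l) : Set (Euc l) :=
  {x | x ∈ Ω ∧ φ x = p}

/-- `u ∈ L²_loc(Ω)`; the values of `u` outside `Ω` are irrelevant. -/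
def MemL2Loc {l : ℕ} {F : Type*} [NormedAddCommGroup F] (Ω : Set (Euc l)) (u : Euc l → F) : Prop :=
  ∀ K : Set (Euc l), K ⊆ Ω → IsCompact K → MemLp u 2 (volume.restrict K)

/-- `w m → u` in `L²_loc(Ω)`. -/
def TendstoL2Loc {l : ℕ} (Ω : Set (Euc l)) (w : ℕ → Euc l → ℝ) (u : Euc l → ℝ) : Prop :=
  ∀ K : Set (Euc l), K ⊆ Ω → IsCompact K →
    Tendsto (fun m => eLpNorm (w m - u) 2 (volume.restrict K)) atTop (𝓝 0)

/-- `g` is (a representative of) the weak gradient `∇u` of `u` on the open set `Ω`. -/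
structure HasWeakGradientOn {l : ℕ} (Ω : Set (Euc l)) (u : Euc l → ℝ) (g : Euc l → Euc l) :
    Prop where
  locallyIntegrable : LocallyIntegrableOn u Ω
  locallyIntegrable_grad : LocallyIntegrableOn g Ω
  integral_eq : ∀ ψ : Euc l → ℝ, ContDiff ℝ ∞ ψ → HasCompactSupport ψ → tsupport ψ ⊆ Ω →
    ∀ v : Euc l, ∫ x in Ω, u x * fderiv ℝ ψ x v = - ∫ x in Ω, ψ x * inner ℝ (g x) v

/-- `u ∈ H¹_loc(Ω)`. -/
def MemH1Loc {l : ℕ} (Ω : Set (Euc l)) (u : Euc l → ℝ) : Prop :=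
  MemL2Loc Ω u ∧ ∃ g : Euc l → Euc l, MemL2Loc Ω g ∧ HasWeakGradientOn Ω u g

/-- `u ∈ H¹(Ω)`. -/
def MemH1 {l : ℕ} (Ω : Set (Euc l)) (u : Euc l → ℝ) : Prop :=
  MemLp u 2 (volume.restrict Ω) ∧
    ∃ g : Euc l → Euc l, MemLp g 2 (volume.restrict Ω) ∧ HasWeakGradientOn Ω u g

/-- `P(x) ∇u(x) = 0` for almost every `x ∈ Ω` (the weak gradient is unique up to null sets). -/
def NormalGradientZero {l : ℕ} (M : Set (Euc l)) (φ : Euc l → Euc l) (Ω : Set (Euc l))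
    (u : Euc l → ℝ) : Prop :=
  ∃ g : Euc l → Euc l, HasWeakGradientOn Ω u g ∧
    ∀ᵐ x ∂(volume.restrict Ω), normalProj M φ x (g x) = 0

/-- `u ∈ H¹_s(Ω)`: `u ∈ H¹(Ω)` and `P(x) ∇u(x) = 0` a.e. in `Ω`. -/
def MemH1s {l : ℕ} (M : Set (Euc l)) (φ : Euc l → Euc l) (Ω : Set (Euc l))
    (u : Euc l → ℝ) : Prop :=
  MemH1 Ω u ∧ NormalGradientZero M φ Ω u

/-- `u ∈ L²_s(Ω)`, the closure of `H¹_s(Ω)` in `L²(Ω)`. -/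
def MemL2s {l : ℕ} (M : Set (Euc l)) (φ : Euc l → Euc l) (Ω : Set (Euc l))
    (u : Euc l → ℝ) : Prop :=
  MemLp u 2 (volume.restrict Ω) ∧
    ∀ ε : ENNReal, 0 < ε → ∃ w : Euc l → ℝ, MemH1s M φ Ω w ∧
      eLpNorm (w - u) 2 (volume.restrict Ω) < ε

/-- `u ∈ L²_loc(Ω)` is the limit in `L²_loc(Ω)` of a sequence of functions `w m ∈ H¹_loc(Ω)` with
`P(x) ∇(w m)(x) = 0` a.e. in `Ω`. -/
def IsL2LocLimit {l : ℕ} (M : Set (Euc l)) (φ : Euc l → Euc l) (Ω : Set (Euc l))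
    (u : Euc l → ℝ) : Prop :=
  MemL2Loc Ω u ∧ ∃ w : ℕ → Euc l → ℝ,
    (∀ m, MemH1Loc Ω (w m)) ∧ (∀ m, NormalGradientZero M φ Ω (w m)) ∧ TendstoL2Loc Ω w u

end

/-! The vector `x - φ x` is the gradient of `‖x - φ x‖² / 2`, so the derivative of `φ` at `x` is
symmetric. Its range is tangent to `M` at `φ x`, hence it kills the normal vectors
(`IsTubularProjection.fderiv_eq_zero`). As `M` is `C²`, the normal projection is a locally Lipschitz
function of `φ x`, and Grönwall's inequality shows that `φ` is constant along short normal segments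
(`IsTubularProjection.exists_ball`). The normal spaces thus form an `IsParallelField`: locally, `x ↦
x + P(x) h` slides points inside their fibres and has a Lipschitz left inverse, which controls the
distortion of volume.

If `P ∇w = 0`, then the derivative of a mollification of `w` along `P` is of the order of the
mollification radius, because `P` is Lipschitz. Integrating along the slides and letting the radius
tend to zero, `w` is a.e. invariant under each small slide (`HasWeakGradientOn.ae_translate_eq`).
Invariance survives `L²_loc` limits. By Fubini, almost every `x` satisfies `u (x + P(x) h) = u x`
for almost every small `h`.

The points violating this form a null set `N`. By an Eilenberg inequality, `N` meets almost every
fibre in an `(ℓ-k)`-null set, which serves as `S_p`. On such a fibre, two nearby points outside `N`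
have a common translate at which both values are attained, so `u` is locally constant off `N`. The
points off `N` are dense in the section, since relatively open pieces of it have positive measure,
and connectedness concludes. -/

/-! ### Perturbation of orthogonal projections -/

/-- With `p i` the projection onto `T i` and `q i = 1 - p i`, one has `q₁ - q₂ = p₂ q₁ - q₂ p₁`, and
`p₂ q₁` is the adjoint of `q₁ p₂`. For `q₂ p₁`: a vector of `T₁` is `B₁ w`, with `w` controlled by
the left inverse, and `q₂` kills `B₂ w`, so only `(B₁ - B₂) w` remains. -/
theorem norm_starProjection_orthogonal_sub_le {E F : Type*}
    [NormedAddCommGroup E] [InnerProductSpace ℝ E] [FiniteDimensional ℝ E]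
    [NormedAddCommGroup F] [NormedSpace ℝ F]
    {T₁ T₂ : Submodule ℝ E} {B₁ B₂ : F →L[ℝ] E} {A₁ A₂ : E →L[ℝ] F} {c : ℝ}
    (hB₁ : T₁ = LinearMap.range B₁.toLinearMap) (hB₂ : T₂ = LinearMap.range B₂.toLinearMap)
    (hA₁ : ∀ w, A₁ (B₁ w) = w) (hA₂ : ∀ w, A₂ (B₂ w) = w)
    (hc₁ : ‖A₁‖ ≤ c) (hc₂ : ‖A₂‖ ≤ c) :
    ‖T₁ᗮ.starProjection - T₂ᗮ.starProjection‖ ≤ 2 * c * ‖B₁ - B₂‖ := by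
  have hc : 0 ≤ c := (norm_nonneg _).trans hc₁
  have key : ∀ {S₁ S₂ : Submodule ℝ E} {C₁ C₂ : F →L[ℝ] E} {D₁ : E →L[ℝ] F},
      S₁ = LinearMap.range C₁.toLinearMap → S₂ = LinearMap.range C₂.toLinearMap →
      (∀ w, D₁ (C₁ w) = w) → ‖D₁‖ ≤ c →
      ‖S₂ᗮ.starProjection ∘L S₁.starProjection‖ ≤ c * ‖C₁ - C₂‖ := by
    intro S₁ S₂ C₁ C₂ D₁ h1 h2 hD hDc
    refine ContinuousLinearMap.opNorm_le_bound _ (by positivity) fun v => ?_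
    have hmem : S₁.starProjection v ∈ LinearMap.range C₁.toLinearMap :=
      h1 ▸ S₁.starProjection_apply_mem v
    obtain ⟨w, hw⟩ := hmem
    have hw' : C₁ w = S₁.starProjection v := hw
    have h0 : S₂ᗮ.starProjection (C₂ w) = 0 := by
      rw [Submodule.starProjection_apply_eq_zero_iff, Submodule.orthogonal_orthogonal, h2]
      exact ⟨w, rfl⟩
    have hwn : ‖w‖ ≤ c * ‖v‖ := by
      calc ‖w‖ = ‖D₁ (C₁ w)‖ := by rw [hD]
        _ ≤ ‖D₁‖ * ‖C₁ w‖ := D₁.le_opNorm _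
        _ ≤ c * ‖v‖ := by
          rw [hw']
          exact mul_le_mul hDc (S₁.norm_starProjection_apply_le v) (norm_nonneg _) hc
    calc ‖S₂ᗮ.starProjection (S₁.starProjection v)‖
        = ‖S₂ᗮ.starProjection ((C₁ - C₂) w)‖ := by
          rw [← hw', sub_apply, map_sub, h0, sub_zero]
      _ ≤ ‖(C₁ - C₂) w‖ := Submodule.norm_starProjection_apply_le _ _
      _ ≤ ‖C₁ - C₂‖ * ‖w‖ := (C₁ - C₂).le_opNorm _
      _ ≤ ‖C₁ - C₂‖ * (c * ‖v‖) := by gcongr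
      _ = c * ‖C₁ - C₂‖ * ‖v‖ := by ring
  have e1 := key hB₁ hB₂ hA₁ hc₁
  have e2 := key hB₂ hB₁ hA₂ hc₂
  have hadj : ContinuousLinearMap.adjoint (T₁ᗮ.starProjection ∘L T₂.starProjection) =
      T₂.starProjection ∘L T₁ᗮ.starProjection := by
    rw [ContinuousLinearMap.adjoint_comp]
    congr 1
    · exact isSelfAdjoint_starProjection _
    · exact isSelfAdjoint_starProjection _
  have e3 : ‖T₂.starProjection ∘L T₁ᗮ.starProjection‖ ≤ c * ‖B₂ - B₁‖ := by
    rw [← hadj, LinearIsometryEquiv.norm_map]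
    exact e2
  have hdec : T₁ᗮ.starProjection - T₂ᗮ.starProjection =
      T₂.starProjection ∘L T₁ᗮ.starProjection - T₂ᗮ.starProjection ∘L T₁.starProjection := by
    ext1 v
    simp only [Submodule.starProjection_orthogonal, sub_apply,
      ContinuousLinearMap.comp_apply, ContinuousLinearMap.id_apply, map_sub]
    abel
  rw [hdec]
  calc _ ≤ c * ‖B₂ - B₁‖ + c * ‖B₁ - B₂‖ := (norm_sub_le _ _).trans (add_le_add e3 e1)
    _ = 2 * c * ‖B₁ - B₂‖ := by rw [norm_sub_rev B₂ B₁]; ring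

/-! ### Slice charts and tangent spaces -/

/-- The frame of the tangent space given by the inverse of a slice chart. -/
noncomputable def chartFrame {l k : ℕ}
    (Ψ : OpenPartialHomeomorph (Euc l) (Euc k × Euc (l - k))) (q : Euc l) : Euc k →L[ℝ] Euc l :=
  (fderiv ℝ Ψ.symm (Ψ q)).comp (ContinuousLinearMap.inl ℝ (Euc k) (Euc (l - k)))

/-- The first component of the derivative of a slice chart, a left inverse of `chartFrame`. -/
noncomputable def chartCoframe {l k : ℕ}
    (Ψ : OpenPartialHomeomorph (Euc l) (Euc k × Euc (l - k))) (q : Euc l) : Euc l →L[ℝ] Euc k :=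
  (ContinuousLinearMap.fst ℝ (Euc k) (Euc (l - k))).comp (fderiv ℝ Ψ q)

section SliceChart

variable {l k : ℕ} {M : Set (Euc l)} {Ψ : OpenPartialHomeomorph (Euc l) (Euc k × Euc (l - k))}
  (hΨ : ContDiffOn ℝ 1 Ψ Ψ.source) (hΨs : ContDiffOn ℝ 1 Ψ.symm Ψ.target) {q : Euc l}

include hΨ in
theorem hasFDerivAt_chart (hq : q ∈ Ψ.source) : HasFDerivAt Ψ (fderiv ℝ Ψ q) q :=
  ((hΨ.contDiffAt (Ψ.open_source.mem_nhds hq)).differentiableAt one_ne_zero).hasFDerivAt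

include hΨs in
theorem hasFDerivAt_chart_symm (hq : q ∈ Ψ.source) :
    HasFDerivAt Ψ.symm (fderiv ℝ Ψ.symm (Ψ q)) (Ψ q) :=
  ((hΨs.contDiffAt (Ψ.open_target.mem_nhds (Ψ.map_source hq))).differentiableAt
    one_ne_zero).hasFDerivAt

include hΨ hΨs

theorem fderiv_chart_fderiv_symm (hq : q ∈ Ψ.source) (w : Euc k × Euc (l - k)) :
    fderiv ℝ Ψ q (fderiv ℝ Ψ.symm (Ψ q) w) = w := by
  have h1 := hasFDerivAt_chart_symm hΨs hq
  have h2 : HasFDerivAt Ψ (fderiv ℝ Ψ q) (Ψ.symm (Ψ q)) := by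
    rw [Ψ.left_inv hq]; exact hasFDerivAt_chart hΨ hq
  have h3 := h2.comp _ h1
  have h4 : HasFDerivAt (Ψ ∘ Ψ.symm) (ContinuousLinearMap.id ℝ _) (Ψ q) := by
    refine (hasFDerivAt_id _).congr_of_eventuallyEq ?_
    filter_upwards [Ψ.open_target.mem_nhds (Ψ.map_source hq)] with y hy
    exact Ψ.right_inv hy
  exact congrArg (fun L => L w) (h3.unique h4)

theorem fderiv_symm_fderiv_chart (hq : q ∈ Ψ.source) (v : Euc l) :
    fderiv ℝ Ψ.symm (Ψ q) (fderiv ℝ Ψ q v) = v := by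
  have h3 := (hasFDerivAt_chart_symm hΨs hq).comp _ (hasFDerivAt_chart hΨ hq)
  have h4 : HasFDerivAt (Ψ.symm ∘ Ψ) (ContinuousLinearMap.id ℝ _) q := by
    refine (hasFDerivAt_id _).congr_of_eventuallyEq ?_
    filter_upwards [Ψ.open_source.mem_nhds hq] with y hy
    exact Ψ.left_inv hy
  exact congrArg (fun L => L v) (h3.unique h4)

theorem chartCoframe_chartFrame (hq : q ∈ Ψ.source) (w : Euc k) :
    chartCoframe Ψ q (chartFrame Ψ q w) = w := by
  simp [chartCoframe, chartFrame, fderiv_chart_fderiv_symm hΨ hΨs hq]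

/-- Along a curve in `M` the second chart coordinate vanishes, hence so does that component of the
velocity. Conversely, straight lines in the slice are carried by `Ψ.symm` to curves in `M`. -/
theorem tangentAt_eq_range_chartFrame (hM : ∀ x ∈ Ψ.source, x ∈ M ↔ (Ψ x).2 = 0)
    (hq : q ∈ Ψ.source) (hqM : q ∈ M) :
    tangentAt M q = LinearMap.range (chartFrame Ψ q).toLinearMap := by
  apply le_antisymm
  · refine Submodule.span_le.2 ?_
    rintro v ⟨γ, hγ0, hγM, hγ⟩
    have hΨγ : HasDerivAt (Ψ ∘ γ) (fderiv ℝ Ψ q v) 0 := by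
      refine HasFDerivAt.comp_hasDerivAt (0 : ℝ) ?_ hγ
      rw [hγ0]; exact hasFDerivAt_chart hΨ hq
    have h2 : HasDerivAt (fun t => (Ψ (γ t)).2) (fderiv ℝ Ψ q v).2 0 :=
      (ContinuousLinearMap.snd ℝ (Euc k) (Euc (l - k))).hasFDerivAt.comp_hasDerivAt (0 : ℝ) hΨγ
    have h3 : HasDerivAt (fun t => (Ψ (γ t)).2) 0 0 := by
      refine (hasDerivAt_const (0 : ℝ) (0 : Euc (l - k))).congr_of_eventuallyEq ?_
      have hs : ∀ᶠ t in 𝓝 (0 : ℝ), γ t ∈ Ψ.source :=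
        hγ.continuousAt.eventually (by rw [hγ0]; exact Ψ.open_source.mem_nhds hq)
      filter_upwards [hγM, hs] with t ht hts
      exact (hM _ hts).1 ht
    have h4 := h2.unique h3
    refine ⟨(fderiv ℝ Ψ q v).1, ?_⟩
    have : ((fderiv ℝ Ψ q v).1, (0 : Euc (l - k))) = fderiv ℝ Ψ q v := by
      rw [← h4]
    simp [chartFrame, this, fderiv_symm_fderiv_chart hΨ hΨs hq]
  · rintro _ ⟨w, rfl⟩
    refine Submodule.subset_span ⟨fun t => Ψ.symm (Ψ q + t • (w, 0)), ?_, ?_, ?_⟩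
    · simp [Ψ.left_inv hq]
    · have hc : ContinuousAt (fun t : ℝ => Ψ q + t • (w, (0 : Euc (l - k)))) 0 := by fun_prop
      have : ∀ᶠ t in 𝓝 (0 : ℝ), Ψ q + t • (w, (0 : Euc (l - k))) ∈ Ψ.target :=
        hc.eventually (by simpa using Ψ.open_target.mem_nhds (Ψ.map_source hq))
      filter_upwards [this] with t ht
      rw [hM _ (Ψ.map_target ht), Ψ.right_inv ht]
      simp [(hM q hq).1 hqM]
    · have h1 : HasDerivAt (fun t : ℝ => Ψ q + t • (w, (0 : Euc (l - k)))) (w, 0) 0 := by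
        simpa using ((hasDerivAt_id (0 : ℝ)).smul_const (w, (0 : Euc (l - k)))).const_add (Ψ q)
      have h2 : HasFDerivAt Ψ.symm (fderiv ℝ Ψ.symm (Ψ q))
          (Ψ q + (0 : ℝ) • (w, (0 : Euc (l - k)))) := by
        simpa using hasFDerivAt_chart_symm hΨs hq
      exact h2.comp_hasDerivAt (0 : ℝ) h1

theorem finrank_tangentAt_of_chart (hM : ∀ x ∈ Ψ.source, x ∈ M ↔ (Ψ x).2 = 0)
    (hq : q ∈ Ψ.source) (hqM : q ∈ M) : Module.finrank ℝ (tangentAt M q) = k := by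
  rw [tangentAt_eq_range_chartFrame hΨ hΨs hM hq hqM, LinearMap.finrank_range_of_inj]
  · simp
  · exact Function.LeftInverse.injective (g := chartCoframe Ψ q)
      (chartCoframe_chartFrame hΨ hΨs hq)

end SliceChart

/-! ### Local Lipschitz and measure bounds on a submanifold -/

section Submanifold

variable {l k r : ℕ} {M : Set (Euc l)}

theorem IsEmbeddedSubmanifold.finrank_tangentAt (hr : 1 ≤ r) (hM : IsEmbeddedSubmanifold k r M)
    {p : Euc l} (hp : p ∈ M) : Module.finrank ℝ (tangentAt M p) = k := by
  obtain ⟨Ψ, hpΨ, h1, h2, h3⟩ := hM p hp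
  have hr' : (1 : WithTop ℕ∞) ≤ r := by exact_mod_cast hr
  exact finrank_tangentAt_of_chart (h1.of_le hr') (h2.of_le hr') h3 hpΨ hp

/-- The orthogonal projection onto the normal space is locally Lipschitz on a `C²` submanifold. -/
theorem IsEmbeddedSubmanifold.exists_normal_lipschitz (hr : 2 ≤ r)
    (hM : IsEmbeddedSubmanifold k r M) {p : Euc l} (hp : p ∈ M) :
    ∃ V ∈ 𝓝 p, ∃ C : ℝ, 0 ≤ C ∧ ∀ q ∈ V ∩ M, ∀ q' ∈ V ∩ M,
      ‖(tangentAt M q)ᗮ.starProjection - (tangentAt M q')ᗮ.starProjection‖ ≤ C * ‖q - q'‖ := by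
  obtain ⟨Ψ, hpΨ, h1, h2, h3⟩ := hM p hp
  have hr1 : (1 : WithTop ℕ∞) ≤ r := by exact_mod_cast (by omega : 1 ≤ r)
  have hr2 : (2 : WithTop ℕ∞) ≤ r := by exact_mod_cast hr
  have hΨ1 := h1.of_le hr1
  have hΨs1 := h2.of_le hr1
  have hsrc : Ψ.source ∈ 𝓝 p := Ψ.open_source.mem_nhds hpΨ
  -- The frame costs one derivative of the chart, so `2 ≤ r` leaves it `C¹`, hence locally
  -- Lipschitz.
  have hframe : ContDiffAt ℝ 1 (chartFrame Ψ) p := by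
    have ha : ContDiffAt ℝ 2 Ψ.symm (Ψ p) :=
      (h2.of_le hr2).contDiffAt (Ψ.open_target.mem_nhds (Ψ.map_source hpΨ))
    have hb : ContDiffAt ℝ 1 (fderiv ℝ Ψ.symm) (Ψ p) :=
      ha.fderiv_right (by norm_num [one_add_one_eq_two])
    have hc : ContDiffAt ℝ 1 (fun q => fderiv ℝ Ψ.symm (Ψ q)) p :=
      hb.comp p (hΨ1.contDiffAt hsrc)
    exact hc.clm_comp contDiffAt_const
  obtain ⟨K, V, hV, hK⟩ := hframe.exists_lipschitzOnWith
  have hco : ContinuousAt (chartCoframe Ψ) p := by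
    have ha : ContinuousAt (fderiv ℝ Ψ) p :=
      ((hΨ1.contDiffAt hsrc).fderiv_right (m := 0) (by norm_num)).continuousAt
    exact continuousAt_const.clm_comp ha
  have hbd : ∀ᶠ q in 𝓝 p, ‖chartCoframe Ψ q‖ < ‖chartCoframe Ψ p‖ + 1 :=
    hco.norm.eventually (gt_mem_nhds (lt_add_one _))
  refine ⟨V ∩ (Ψ.source ∩ {q | ‖chartCoframe Ψ q‖ < ‖chartCoframe Ψ p‖ + 1}),
    inter_mem hV (inter_mem hsrc hbd), 2 * (‖chartCoframe Ψ p‖ + 1) * K, by positivity, ?_⟩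
  rintro q ⟨⟨hqV, hqs, hqb⟩, hqM⟩ q' ⟨⟨hqV', hqs', hqb'⟩, hqM'⟩
  have := norm_starProjection_orthogonal_sub_le
    (tangentAt_eq_range_chartFrame hΨ1 hΨs1 h3 hqs hqM)
    (tangentAt_eq_range_chartFrame hΨ1 hΨs1 h3 hqs' hqM')
    (chartCoframe_chartFrame hΨ1 hΨs1 hqs) (chartCoframe_chartFrame hΨ1 hΨs1 hqs')
    (le_of_lt hqb) (le_of_lt hqb')
  refine this.trans ?_
  have hd := hK.dist_le_mul q hqV q' hqV'
  rw [dist_eq_norm, dist_eq_norm] at hd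
  rw [mul_assoc _ (K : ℝ)]
  gcongr

/-- The `k`-dimensional measure of a subset of `ℝ^k` is bounded by the `k`-th power of its
diameter. -/
theorem exists_hausdorffMeasure_le_ediam_rpow {k : ℕ} (hk : 1 ≤ k) :
    ∃ c : ENNReal, c ≠ ⊤ ∧ ∀ D : Set (Euc k), μH[(k : ℝ)] D ≤ c * Metric.ediam D ^ (k : ℝ) := by
  have hH : (μH[(k : ℝ)] : Measure (Euc k)).IsAddHaarMeasure := by
    have h : (μH[(Module.finrank ℝ (Euc k) : ℝ)] : Measure (Euc k)).IsAddHaarMeasure :=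
      isAddHaarMeasure_hausdorffMeasure
    rwa [finrank_euclideanSpace_fin] at h
  have hk0 : (0 : ℝ) < k := by exact_mod_cast hk
  refine ⟨μH[(k : ℝ)] (Metric.closedBall (0 : Euc k) 1),
    (isCompact_closedBall _ _).measure_ne_top, fun D => ?_⟩
  rcases D.eq_empty_or_nonempty with rfl | ⟨x, hx⟩
  · simp
  by_cases htop : Metric.ediam D = ⊤
  · rw [htop, ENNReal.top_rpow_of_pos hk0, ENNReal.mul_top]
    · exact le_top
    · exact (Metric.measure_closedBall_pos _ _ one_pos).ne'
  · have hsub : D ⊆ Metric.closedBall x (Metric.ediam D).toReal := by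
      intro y hy
      rw [Metric.mem_closedBall, dist_edist]
      exact ENNReal.toReal_mono htop (Metric.edist_le_ediam_of_mem hy hx)
    refine (measure_mono hsub).trans ?_
    rw [Measure.addHaar_closedBall' _ _ ENNReal.toReal_nonneg, finrank_euclideanSpace_fin,
      ENNReal.ofReal_pow ENNReal.toReal_nonneg, ENNReal.ofReal_toReal htop, mul_comm,
      ENNReal.rpow_natCast]

/-- The `k`-dimensional measure of a piece of a `k`-dimensional submanifold is locally bounded by
the `k`-th power of its diameter. -/
theorem IsEmbeddedSubmanifold.exists_hausdorffMeasure_le (hk : 1 ≤ k) (hr : 1 ≤ r)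
    (hM : IsEmbeddedSubmanifold k r M) {p : Euc l} (hp : p ∈ M) :
    ∃ V ∈ 𝓝 p, ∃ C : ENNReal, C ≠ ⊤ ∧ ∀ A ⊆ V ∩ M,
      μH[(k : ℝ)] A ≤ C * Metric.ediam A ^ (k : ℝ) := by
  obtain ⟨Ψ, hpΨ, h1, h2, h3⟩ := hM p hp
  have hr1 : (1 : WithTop ℕ∞) ≤ r := by exact_mod_cast hr
  have hsrc : Ψ.source ∈ 𝓝 p := Ψ.open_source.mem_nhds hpΨ
  have hΨ1 : ContDiffAt ℝ 1 Ψ p := (h1.of_le hr1).contDiffAt hsrc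
  have hΨs1 : ContDiffAt ℝ 1 Ψ.symm (Ψ p) :=
    (h2.of_le hr1).contDiffAt (Ψ.open_target.mem_nhds (Ψ.map_source hpΨ))
  obtain ⟨K, V, hV, hK⟩ := hΨ1.exists_lipschitzOnWith
  obtain ⟨K', V', hV', hK'⟩ := hΨs1.exists_lipschitzOnWith
  obtain ⟨c, hc, hcD⟩ := exists_hausdorffMeasure_le_ediam_rpow hk
  have hk0 : (0 : ℝ) ≤ k := by positivity
  refine ⟨V ∩ (Ψ.source ∩ Ψ ⁻¹' V'),
    inter_mem hV (inter_mem hsrc (hΨ1.continuousAt.preimage_mem_nhds hV')),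
    (K' : ENNReal) ^ (k : ℝ) * (c * (K : ENNReal) ^ (k : ℝ)), ?_, fun A hA => ?_⟩
  · exact ENNReal.mul_ne_top (ENNReal.rpow_ne_top_of_nonneg hk0 ENNReal.coe_ne_top)
      (ENNReal.mul_ne_top hc (ENNReal.rpow_ne_top_of_nonneg hk0 ENNReal.coe_ne_top))
  -- The chart flattens `A` to `D ⊆ ℝ^k`, where the diameter bound is known. Going down costs the
  -- factor `K` in the diameter, coming back costs `K' ^ k` in the measure.
  set D : Set (Euc k) := (fun x => (Ψ x).1) '' A with hD
  have hΨA : ∀ x ∈ A, Ψ x = ((Ψ x).1, 0) := fun x hx => by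
    rw [← (h3 x (hA hx).1.2.1).1 (hA hx).2]
  have hsub : A ⊆ Ψ.symm '' ((fun w => (w, (0 : Euc (l - k)))) '' D) := by
    intro x hx
    refine ⟨Ψ x, ⟨(Ψ x).1, ⟨x, hx, rfl⟩, (hΨA x hx).symm⟩, Ψ.left_inv (hA hx).1.2.1⟩
  have hDV : (fun w => (w, (0 : Euc (l - k)))) '' D ⊆ V' := by
    rintro _ ⟨_, ⟨x, hx, rfl⟩, rfl⟩
    have := (hA hx).1.2.2
    rw [mem_preimage, hΨA x hx] at this
    exact this
  have hiso : Isometry (fun w : Euc k => (w, (0 : Euc (l - k)))) := by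
    intro a b
    simp [Prod.edist_eq]
  have hdiam : Metric.ediam D ≤ K * Metric.ediam A := by
    refine Metric.ediam_image_le_iff.2 fun x hx y hy => ?_
    calc edist (Ψ x).1 (Ψ y).1 ≤ edist (Ψ x) (Ψ y) := le_max_left _ _
      _ ≤ K * edist x y := hK (hA hx).1.1 (hA hy).1.1
      _ ≤ K * Metric.ediam A := by gcongr; exact Metric.edist_le_ediam_of_mem hx hy
  calc μH[(k : ℝ)] A ≤ _ := measure_mono hsub
    _ ≤ (K' : ENNReal) ^ (k : ℝ) * μH[(k : ℝ)] ((fun w => (w, (0 : Euc (l - k)))) '' D) :=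
      (hK'.mono hDV).hausdorffMeasure_image_le hk0
    _ = (K' : ENNReal) ^ (k : ℝ) * μH[(k : ℝ)] D := by
      rw [hiso.hausdorffMeasure_image (Or.inl hk0)]
    _ ≤ (K' : ENNReal) ^ (k : ℝ) * (c * (K * Metric.ediam A) ^ (k : ℝ)) := by
      gcongr
      exact (hcD D).trans (by gcongr)
    _ = _ := by rw [ENNReal.mul_rpow_of_nonneg _ _ hk0]; ring

end Submanifold

/-! ### Tubular projections are constant along normal directions -/

section Tubular

variable {l k r s : ℕ} {M U : Set (Euc l)} {φ : Euc l → Euc l}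

theorem IsTubularProjection.contDiffAt (hs : 1 ≤ s) (hφ : IsTubularProjection s M U φ)
    {x : Euc l} (hx : x ∈ U) : ContDiffAt ℝ 1 φ x :=
  (hφ.contDiffOn.of_le (by exact_mod_cast hs)).contDiffAt (hφ.isOpen.mem_nhds hx)

theorem IsTubularProjection.hasFDerivAt (hs : 1 ≤ s) (hφ : IsTubularProjection s M U φ)
    {x : Euc l} (hx : x ∈ U) : HasFDerivAt φ (fderiv ℝ φ x) x :=
  ((hφ.contDiffAt hs hx).differentiableAt one_ne_zero).hasFDerivAt

theorem IsTubularProjection.fderiv_mem (hs : 1 ≤ s) (hφ : IsTubularProjection s M U φ)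
    {x : Euc l} (hx : x ∈ U) (v : Euc l) : fderiv ℝ φ x v ∈ tangentAt M (φ x) := by
  refine Submodule.subset_span ⟨fun t => φ (x + t • v), by simp, ?_, ?_⟩
  · have hc : ContinuousAt (fun t : ℝ => x + t • v) 0 := by fun_prop
    have : ∀ᶠ t in 𝓝 (0 : ℝ), x + t • v ∈ U :=
      hc.eventually (by simpa using hφ.isOpen.mem_nhds hx)
    filter_upwards [this] with t ht using hφ.mapsTo ht
  · have h1 : HasDerivAt (fun t : ℝ => x + t • v) v 0 := by
      simpa using ((hasDerivAt_id (0 : ℝ)).smul_const v).const_add x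
    have h2 : HasFDerivAt φ (fderiv ℝ φ x) (x + (0 : ℝ) • v) := by
      simpa using hφ.hasFDerivAt hs hx
    exact h2.comp_hasDerivAt (0 : ℝ) h1

/-- The derivative of a tubular projection is symmetric: `x - φ x` is the gradient of
`‖x - φ x‖² / 2`. -/
theorem IsTubularProjection.inner_fderiv_comm (hs : 1 ≤ s) (hφ : IsTubularProjection s M U φ)
    {x : Euc l} (hx : x ∈ U) (v w : Euc l) :
    inner ℝ (fderiv ℝ φ x v) w = inner ℝ v (fderiv ℝ φ x w) := by
  -- The term with the derivative of `φ` drops out, being tangential while `y - φ y` is normal. The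
  -- gradient therefore involves no derivative of `φ`, and `C¹` regularity of `φ` suffices for a
  -- second derivative.
  have hf : ∀ᶠ y in 𝓝 x, HasFDerivAt (fun y => (1 / 2 : ℝ) * ‖y - φ y‖ ^ 2)
      (innerSL ℝ (y - φ y)) y := by
    filter_upwards [hφ.isOpen.mem_nhds hx] with y hy
    have h1 := ((((hasFDerivAt_id y).sub (hφ.hasFDerivAt hs hy)).norm_sq).const_mul (1 / 2 : ℝ))
    refine h1.congr_fderiv ?_
    ext z
    have h0 : inner ℝ (y - φ y) (fderiv ℝ φ y z) = 0 :=
      Submodule.inner_left_of_mem_orthogonal (hφ.fderiv_mem hs hy z) (hφ.orthogonal y hy)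
    rw [inner_sub_left] at h0
    simp [h0]
  have hf' : HasFDerivAt (fun y => innerSL ℝ (y - φ y))
      ((innerSL ℝ (E := Euc l)).comp (ContinuousLinearMap.id ℝ _ - fderiv ℝ φ x)) x :=
    (innerSL ℝ (E := Euc l)).hasFDerivAt.comp x ((hasFDerivAt_id x).sub (hφ.hasFDerivAt hs hx))
  have := second_derivative_symmetric_of_eventually hf hf' v w
  simp only [ContinuousLinearMap.comp_apply, sub_apply,
    ContinuousLinearMap.id_apply, innerSL_apply_apply, inner_sub_left] at this
  rw [real_inner_comm w v] at this
  rw [real_inner_comm _ v]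
  linarith

/-- A symmetric map vanishes on the orthogonal complement of its range, and the range is tangential.
-/
theorem IsTubularProjection.fderiv_eq_zero (hs : 1 ≤ s) (hφ : IsTubularProjection s M U φ)
    {x : Euc l} (hx : x ∈ U) {n : Euc l} (hn : n ∈ (tangentAt M (φ x))ᗮ) : fderiv ℝ φ x n = 0 := by
  refine ext_inner_right ℝ fun w => ?_
  rw [hφ.inner_fderiv_comm hs hx, inner_zero_left]
  exact Submodule.inner_left_of_mem_orthogonal (hφ.fderiv_mem hs hx w) hn

/-- Around each point of `U` there is a ball on which the tubular projection and the normal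
projection are Lipschitz, and on which the tubular projection is constant along normal spaces. -/
theorem IsTubularProjection.exists_ball (hs : 1 ≤ s) (hφ : IsTubularProjection s M U φ)
    (hr : 2 ≤ r) (hM : IsEmbeddedSubmanifold k r M) {x₀ : Euc l} (hx₀ : x₀ ∈ U) :
    ∃ ρ > 0, Metric.ball x₀ ρ ⊆ U ∧ ∃ L : NNReal,
      LipschitzOnWith L (normalProj M φ) (Metric.ball x₀ ρ) ∧
      ∀ x ∈ Metric.ball x₀ ρ, ∀ n ∈ (tangentAt M (φ x))ᗮ, x + n ∈ Metric.ball x₀ ρ →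
        φ (x + n) = φ x := by
  obtain ⟨V, hV, C, hC, hVC⟩ := hM.exists_normal_lipschitz hr (hφ.mapsTo hx₀)
  obtain ⟨K, W, hW, hK⟩ := (hφ.contDiffAt hs hx₀).exists_lipschitzOnWith
  have hmem : W ∩ (U ∩ φ ⁻¹' V) ∈ 𝓝 x₀ := inter_mem hW (inter_mem (hφ.isOpen.mem_nhds hx₀)
    ((hφ.contDiffAt hs hx₀).continuousAt.preimage_mem_nhds hV))
  obtain ⟨ρ, hρ, hsub⟩ := Metric.mem_nhds_iff.1 hmem
  -- The bound is by `‖φ x - φ y‖`, not merely by `‖x - y‖`: this is what closes the Grönwall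
  -- argument.
  have hP : ∀ x ∈ Metric.ball x₀ ρ, ∀ y ∈ Metric.ball x₀ ρ,
      ‖normalProj M φ x - normalProj M φ y‖ ≤ C * ‖φ x - φ y‖ := fun x hx y hy =>
    hVC _ ⟨(hsub hx).2.2, hφ.mapsTo (hsub hx).2.1⟩ _ ⟨(hsub hy).2.2, hφ.mapsTo (hsub hy).2.1⟩
  refine ⟨ρ, hρ, fun x hx => (hsub hx).2.1, C.toNNReal * K, ?_, ?_⟩
  · refine LipschitzOnWith.of_dist_le_mul fun x hx y hy => ?_
    have h1 := hK.dist_le_mul x (hsub hx).1 y (hsub hy).1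
    rw [dist_eq_norm] at h1 ⊢
    rw [NNReal.coe_mul, Real.coe_toNNReal _ hC, mul_assoc]
    exact (hP x hx y hy).trans (by gcongr)
  · intro x hx n hn hxn
    have hy : ∀ t ∈ Icc (0 : ℝ) 1, x + t • n ∈ Metric.ball x₀ ρ := fun t ht =>
      (convex_ball x₀ ρ).add_smul_mem hx hxn ht
    have hder : ∀ t ∈ Icc (0 : ℝ) 1, HasDerivAt (fun t : ℝ => φ (x + t • n) - φ x)
        (fderiv ℝ φ (x + t • n) n) t := fun t ht => by
      have h1 : HasDerivAt (fun t : ℝ => x + t • n) n t := by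
        simpa using ((hasDerivAt_id t).smul_const n).const_add x
      exact ((hφ.hasFDerivAt hs (hsub (hy t ht)).2.1).comp_hasDerivAt t h1).sub_const _
    -- The derivative at `y` kills `P(y) n`, and `n = P(x) n`, so it sees only `(P(x) - P(y)) n`.
    -- This is bounded by the increment of `φ` itself, which starts at zero.
    have hbound : ∀ t ∈ Ico (0 : ℝ) 1, ‖fderiv ℝ φ (x + t • n) n‖ ≤
        (K * C * ‖n‖) * ‖φ (x + t • n) - φ x‖ + 0 := fun t ht => by
      have hyt := hy t (Ico_subset_Icc_self ht)
      set y := x + t • n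
      have hPn : normalProj M φ x n = n := Submodule.starProjection_eq_self_iff.2 hn
      have h0 : fderiv ℝ φ y (normalProj M φ y n) = 0 :=
        hφ.fderiv_eq_zero hs (hsub hyt).2.1 (Submodule.starProjection_apply_mem _ _)
      have h1 : fderiv ℝ φ y n = fderiv ℝ φ y ((normalProj M φ x - normalProj M φ y) n) := by
        rw [sub_apply, hPn, map_sub, h0, sub_zero]
      have hD : ‖fderiv ℝ φ y‖ ≤ K :=
        (hφ.hasFDerivAt hs (hsub hyt).2.1).le_of_lipschitzOn
          (Filter.mem_of_superset (Metric.isOpen_ball.mem_nhds hyt) fun z hz => (hsub hz).1) hK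
      rw [h1, add_zero]
      calc _ ≤ ‖fderiv ℝ φ y‖ * (‖normalProj M φ x - normalProj M φ y‖ * ‖n‖) :=
            (ContinuousLinearMap.le_opNorm _ _).trans (by
              gcongr; exact ContinuousLinearMap.le_opNorm _ _)
        _ ≤ K * ((C * ‖φ x - φ y‖) * ‖n‖) := by gcongr; exact hP x hx y hyt
        _ = _ := by rw [norm_sub_rev]; ring
    have := norm_le_gronwallBound_of_norm_deriv_right_le (δ := 0) (ε := 0)
      (fun t ht => (hder t ht).continuousAt.continuousWithinAt)
      (fun t ht => (hder t (Ico_subset_Icc_self ht)).hasDerivWithinAt) (by simp) hbound 1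
      (right_mem_Icc.2 zero_le_one)
    rw [gronwallBound_ε0_δ0, one_smul, norm_le_zero_iff, sub_eq_zero] at this
    exact this

end Tubular

/-! ### Null sets, Lipschitz maps and fibres -/

/-- Lebesgue measure is a constant multiple of `μH[l]`, for which the Lipschitz bound is standard.
-/
theorem volume_image_le_of_lipschitzOn {l : ℕ} {S : Euc l → Euc l} {B : Set (Euc l)} {K : NNReal}
    (hS : LipschitzOnWith K S B) : volume (S '' B) ≤ (K : ENNReal) ^ l * volume B := by
  rw [← EuclideanSpace.euclideanHausdorffMeasure_eq_volume,
    Measure.euclideanHausdorffMeasure_def]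
  simp only [Measure.smul_apply, ENNReal.smul_def, smul_eq_mul]
  rw [mul_left_comm]
  gcongr
  simpa using hS.hausdorffMeasure_image_le (d := l) (by positivity)

theorem hausdorffMeasure_eq_zero_of_volume_eq_zero {l : ℕ} {N : Set (Euc l)}
    (hN : volume N = 0) : μH[(l : ℝ)] N = 0 := by
  rw [← EuclideanSpace.euclideanHausdorffMeasure_eq_volume,
    Measure.euclideanHausdorffMeasure_def] at hN
  simp only [Measure.smul_apply, ENNReal.smul_def, smul_eq_mul, mul_eq_zero,
    ENNReal.coe_eq_zero] at hN
  exact hN.resolve_left (Measure.addHaarScalarFactor_volume_hausdorffMeasure_ne_zero l)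

/-- A map with a Lipschitz left inverse distorts volume in a controlled way. -/
theorem map_restrict_le_of_leftInverse {l : ℕ} {T S : Euc l → Euc l} {W B : Set (Euc l)}
    {K : NNReal} (hW : MeasurableSet W) (hT : ContinuousOn T W)
    (hTB : MapsTo T W B) (hS : LipschitzOnWith K S B) (hST : ∀ x ∈ W, S (T x) = x) :
    (volume.restrict W).map T ≤ ((K : ENNReal) ^ l) • volume.restrict B := by
  refine Measure.le_iff.2 fun A hA => ?_
  rw [Measure.map_apply_of_aemeasurable (hT.aemeasurable hW) hA, Measure.restrict_apply' hW,
    Measure.smul_apply, Measure.restrict_apply hA, smul_eq_mul]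
  refine le_trans (measure_mono ?_)
    (volume_image_le_of_lipschitzOn (hS.mono (inter_subset_right (s := A))))
  rintro x ⟨hxA, hxW⟩
  exact ⟨T x, ⟨hxA, hTB hxW⟩, hST x hxW⟩

/-- Nullity forces the infimum over covers to vanish at every scale `r`. Intersecting the pieces
with `N` keeps them where `φ` will be Lipschitz; since `0 < d`, pieces that become empty cost
nothing. -/
theorem exists_cover_of_hausdorffMeasure_eq_zero {X : Type*} [EMetricSpace X] [MeasurableSpace X]
    [BorelSpace X] {d : ℝ} (hd : 0 < d) {N : Set X} (hN : μH[d] N = 0) {r ε : ENNReal}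
    (hr : 0 < r) (hε : 0 < ε) :
    ∃ t : ℕ → Set X, N = ⋃ i, t i ∧ (∀ i, Metric.ediam (t i) ≤ r) ∧
      ∑' i, Metric.ediam (t i) ^ d < ε := by
  rw [Measure.hausdorffMeasure_apply] at hN
  have h1 := (iSup_eq_bot.1 (iSup_eq_bot.1 hN r)) hr
  have h2 := h1.trans_lt hε
  simp only [iInf_lt_iff] at h2
  obtain ⟨t, htN, htr, hts⟩ := h2
  refine ⟨fun i => t i ∩ N, ?_, fun i => (Metric.ediam_mono inter_subset_left).trans (htr i), ?_⟩
  · rw [← iUnion_inter, inter_eq_self_of_subset_right htN]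
  · refine lt_of_le_of_lt (ENNReal.tsum_le_tsum fun i => ?_) hts
    rcases (t i ∩ N).eq_empty_or_nonempty with he | hne
    · simp [he, hd]
    · refine le_iSup_of_le (hne.mono inter_subset_left) ?_
      exact ENNReal.rpow_le_rpow (Metric.ediam_mono inter_subset_left) hd.le

/-- A form of Eilenberg's inequality: if `φ` is Lipschitz on a set of vanishing
`(d₁ + d₂)`-dimensional measure and the `d₁`-dimensional measure of subsets of its image is
controlled by their diameter, then almost all fibres have vanishing `d₂`-dimensional measure. -/
theorem hausdorffMeasure_fibre_eq_zero {X Y : Type*} [EMetricSpace X] [MeasurableSpace X]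
    [BorelSpace X] [EMetricSpace Y] [MeasurableSpace Y] [BorelSpace Y] {d₁ d₂ : ℝ} (h₁ : 0 < d₁)
    (h₂ : 0 < d₂) {φ : X → Y} {N : Set X} {K : NNReal} {C : ENNReal} (hC : C ≠ ⊤)
    (hφ : LipschitzOnWith K φ N)
    (hY : ∀ A ⊆ φ '' N, μH[d₁] A ≤ C * Metric.ediam A ^ d₁) (hN : μH[d₁ + d₂] N = 0) :
    μH[d₁] {p | μH[d₂] (N ∩ φ ⁻¹' {p}) ≠ 0} = 0 := by
  obtain ⟨ε, hε, hεsum⟩ := ENNReal.exists_pos_sum_of_countable' one_ne_zero ℕ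
  -- Covers at scale `1 / n` and cost `ε n` with `∑ ε n` finite. At `n = 0` the scale is `⊤`, which
  -- is no constraint.
  have hcov := fun n : ℕ => exists_cover_of_hausdorffMeasure_eq_zero (add_pos h₁ h₂) hN
    (ENNReal.inv_pos.2 (ENNReal.natCast_ne_top n)) (hε n)
  choose t htN htr hts using hcov
  have htsub : ∀ n i, t n i ⊆ N := fun n i => by rw [htN n]; exact subset_iUnion _ i
  -- Images of arbitrary pieces need not be measurable; their hulls have the same measure.
  set A : ℕ → ℕ → Set Y := fun n i => toMeasurable μH[d₁] (φ '' t n i)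
  -- `g n p` bounds the cost of covering the fibre over `p` by the traces of the pieces.
  set g : ℕ → Y → ENNReal := fun n p =>
    ∑' i, (A n i).indicator (fun _ => Metric.ediam (t n i) ^ d₂) p with hg
  have hmeas : ∀ n i, Measurable ((A n i).indicator (fun _ => Metric.ediam (t n i) ^ d₂)) :=
    fun n i => measurable_const.indicator (measurableSet_toMeasurable _ _)
  have hgm : ∀ n, Measurable (g n) := fun n => Measurable.tsum (hmeas n)
  have hterm : ∀ n i, Metric.ediam (t n i) ^ d₂ * μH[d₁] (φ '' t n i) ≤
      C * (K : ENNReal) ^ d₁ * Metric.ediam (t n i) ^ (d₁ + d₂) := fun n i => by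
    have hd : Metric.ediam (φ '' t n i) ≤ K * Metric.ediam (t n i) :=
      Metric.ediam_image_le_iff.2 fun x hx y hy => (hφ (htsub n i hx) (htsub n i hy)).trans (by
        gcongr; exact Metric.edist_le_ediam_of_mem hx hy)
    calc _ ≤ Metric.ediam (t n i) ^ d₂ * (C * (K * Metric.ediam (t n i)) ^ d₁) := by
          gcongr
          exact (hY _ (image_mono (htsub n i))).trans (by gcongr)
      _ = _ := by
          rw [ENNReal.mul_rpow_of_nonneg _ _ h₁.le, ENNReal.rpow_add_of_nonneg _ _ h₁.le h₂.le]
          ring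
  -- By `hterm` each `g n` has integral at most `C * K ^ d₁ * ε n`. The sum over `n` is thus finite
  -- almost everywhere, which forces `g n p → 0` there.
  have hint : ∫⁻ p, ∑' n, g n p ∂μH[d₁] ≠ ⊤ := by
    rw [lintegral_tsum fun n => (hgm n).aemeasurable]
    have : ∀ n, ∫⁻ p, g n p ∂μH[d₁] ≤ C * (K : ENNReal) ^ d₁ * ε n := fun n => by
      rw [hg, lintegral_tsum fun i => (hmeas n i).aemeasurable]
      calc _ ≤ ∑' i, C * (K : ENNReal) ^ d₁ * Metric.ediam (t n i) ^ (d₁ + d₂) := by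
            refine ENNReal.tsum_le_tsum fun i => ?_
            rw [lintegral_indicator_const (measurableSet_toMeasurable _ _), measure_toMeasurable]
            exact hterm n i
        _ ≤ _ := by
            rw [ENNReal.tsum_mul_left]
            gcongr
            exact (hts n).le
    refine ne_top_of_le_ne_top ?_ (ENNReal.tsum_le_tsum this)
    rw [ENNReal.tsum_mul_left]
    exact ENNReal.mul_ne_top (ENNReal.mul_ne_top hC
      (ENNReal.rpow_ne_top_of_nonneg h₁.le ENNReal.coe_ne_top)) (hεsum.trans_le le_top).ne
  have hae := ae_lt_top (Measurable.tsum hgm) hint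
  refine measure_mono_null ?_ (ae_iff.1 hae)
  intro p hp hlt
  refine hp (le_antisymm ?_ zero_le)
  have hlim : Tendsto (fun n => g n p) atTop (𝓝 0) :=
    ENNReal.tendsto_atTop_zero_of_tsum_ne_top hlt.ne
  refine (Measure.hausdorffMeasure_le_liminf_tsum d₂ (N ∩ φ ⁻¹' {p}) (l := atTop)
    (fun n : ℕ => ((n : ENNReal))⁻¹) ENNReal.tendsto_inv_nat_nhds_zero
    (fun n i => t n i ∩ φ ⁻¹' {p})
    (Eventually.of_forall fun n i => (Metric.ediam_mono inter_subset_left).trans (htr n i))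
    (Eventually.of_forall fun n => ?_)).trans ?_
  · rw [← iUnion_inter, ← htN n]
  · rw [← hlim.liminf_eq]
    refine liminf_le_liminf (Eventually.of_forall fun n => ENNReal.tsum_le_tsum fun i => ?_)
    rcases (t n i ∩ φ ⁻¹' {p}).eq_empty_or_nonempty with he | ⟨x, hx, hxp⟩
    · simp [he, h₂]
    · have hpA : p ∈ A n i := subset_toMeasurable _ _ ⟨x, hx, hxp⟩
      rw [indicator_of_mem hpA]
      exact ENNReal.rpow_le_rpow (Metric.ediam_mono inter_subset_left) h₂.le

/-- Null sets meet almost all fibres of a tubular projection in null sets. -/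
theorem IsTubularProjection.hausdorffMeasure_fibre_eq_zero {l k r s : ℕ} {M U : Set (Euc l)}
    {φ : Euc l → Euc l} (hk : 1 ≤ k) (hkl : k < l) (hs : 1 ≤ s)
    (hφ : IsTubularProjection s M U φ) (hr : 1 ≤ r) (hM : IsEmbeddedSubmanifold k r M)
    {N : Set (Euc l)} (hNU : N ⊆ U) (hN : volume N = 0) :
    μH[(k : ℝ)] {p | μH[(l : ℝ) - k] (N ∩ φ ⁻¹' {p}) ≠ 0} = 0 := by
  have hk0 : (0 : ℝ) < k := by exact_mod_cast hk
  have hlk : (0 : ℝ) < (l : ℝ) - k := sub_pos.2 (by exact_mod_cast hkl)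
  have hloc : ∀ x ∈ U, ∃ W ∈ 𝓝 x, ∃ K : NNReal, LipschitzOnWith K φ W ∧ W ⊆ U ∧
      ∃ C : ENNReal, C ≠ ⊤ ∧ ∀ A ⊆ φ '' W, μH[(k : ℝ)] A ≤ C * Metric.ediam A ^ (k : ℝ) := by
    intro x hx
    obtain ⟨V, hV, C, hC, hVC⟩ := hM.exists_hausdorffMeasure_le hk hr (hφ.mapsTo hx)
    obtain ⟨K, W, hW, hK⟩ := (hφ.contDiffAt hs hx).exists_lipschitzOnWith
    refine ⟨W ∩ (U ∩ φ ⁻¹' V), inter_mem hW (inter_mem (hφ.isOpen.mem_nhds hx)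
      ((hφ.contDiffAt hs hx).continuousAt.preimage_mem_nhds hV)), K, hK.mono inter_subset_left,
      fun y hy => hy.2.1, C, hC, fun A hA => hVC A fun a ha => ?_⟩
    obtain ⟨y, hy, rfl⟩ := hA ha
    exact ⟨hy.2.2, hφ.mapsTo hy.2.1⟩
  choose! W hW K hK _ C hC hCA using hloc
  -- By the Lindelöf property, countably many of the local neighbourhoods suffice.
  obtain ⟨I, hIU, hI, hUI⟩ := TopologicalSpace.countable_cover_nhdsWithin
    (fun x hx => mem_nhdsWithin_of_mem_nhds (hW x hx))
  have hnull : ∀ x ∈ I, μH[(k : ℝ)] {p | μH[(l : ℝ) - k] ((N ∩ W x) ∩ φ ⁻¹' {p}) ≠ 0} = 0 := by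
    intro x hx
    refine _root_.hausdorffMeasure_fibre_eq_zero hk0 hlk (hC x (hIU hx))
      ((hK x (hIU hx)).mono inter_subset_right)
      (fun A hA => hCA x (hIU hx) A (hA.trans (image_mono inter_subset_right))) ?_
    rw [add_sub_cancel]
    exact measure_mono_null inter_subset_left (hausdorffMeasure_eq_zero_of_volume_eq_zero hN)
  refine measure_mono_null (fun p hp => ?_) ((measure_biUnion_null_iff hI).2 hnull)
  by_contra hcon
  simp only [mem_iUnion, not_exists, mem_ofPred_eq, not_not] at hcon
  refine hp (measure_mono_null (fun y hy => ?_) ((measure_biUnion_null_iff hI).2 hcon))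
  obtain ⟨x, hx, hyx⟩ := mem_iUnion₂.1 (hUI (hNU hy.1))
  exact mem_iUnion₂.2 ⟨x, hx, ⟨hy.1, hyx⟩, hy.2⟩

/-! ### Parallel fields and their translations -/

/-- A Lipschitz field of linear subspaces on `B` that is constant along its own directions. -/
structure IsParallelField {l : ℕ} (K : Euc l → Submodule ℝ (Euc l)) (L : NNReal)
    (B : Set (Euc l)) : Prop where
  lipschitz : LipschitzOnWith L (fun x => (K x).starProjection) B
  invariant : ∀ x ∈ B, ∀ n ∈ K x, x + n ∈ B → K (x + n) = K x

namespace IsParallelField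

variable {l : ℕ} {K : Euc l → Submodule ℝ (Euc l)} {L : NNReal} {x₀ : Euc l} {R : ℝ}

theorem mapsTo_ball {h : Euc l} (hh : ‖h‖ < R) :
    MapsTo (fun x => x + (K x).starProjection h) (Metric.ball x₀ R) (Metric.ball x₀ (2 * R)) := by
  intro x hx
  rw [Metric.mem_ball, dist_eq_norm] at hx ⊢
  calc ‖x + (K x).starProjection h - x₀‖ = ‖(x - x₀) + (K x).starProjection h‖ := by congr 1; abel
    _ ≤ ‖x - x₀‖ + ‖(K x).starProjection h‖ := norm_add_le _ _
    _ < R + R := add_lt_add_of_lt_of_le hx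
        (((K x).norm_starProjection_apply_le h).trans hh.le)
    _ = 2 * R := by ring

theorem continuousOn {B : Set (Euc l)} (hK : IsParallelField K L B) (h : Euc l) :
    ContinuousOn (fun x => x + (K x).starProjection h) B :=
  continuousOn_id.add (hK.lipschitz.continuousOn.clm_apply continuousOn_const)

/-- The translations along a parallel field distort volume in a controlled way. -/
theorem map_restrict_le (hK : IsParallelField K L (Metric.ball x₀ (2 * R))) {h : Euc l}
    (hh : ‖h‖ < R) :
    (volume.restrict (Metric.ball x₀ R)).map (fun x => x + (K x).starProjection h) ≤
      (((1 + L * R.toNNReal : NNReal) : ENNReal) ^ l) •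
        volume.restrict (Metric.ball x₀ (2 * R)) := by
  have hR : 0 < R := (norm_nonneg h).trans_lt hh
  have hsub : Metric.ball x₀ R ⊆ Metric.ball x₀ (2 * R) := Metric.ball_subset_ball (by linarith)
  -- The field is the same at `x` and at its translate, so subtracting the projection of `h` undoes
  -- the translation. This left inverse has Lipschitz constant `1 + L * R`, as `‖h‖ < R`.
  refine map_restrict_le_of_leftInverse (S := fun y => y - (K y).starProjection h)
    Metric.isOpen_ball.measurableSet ((hK.continuousOn h).mono hsub) (mapsTo_ball hh) ?_ ?_
  · refine LipschitzOnWith.of_dist_le_mul fun x hx y hy => ?_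
    have h1 := hK.lipschitz.dist_le_mul x hx y hy
    rw [dist_eq_norm] at h1
    calc dist (x - (K x).starProjection h) (y - (K y).starProjection h)
        = ‖(x - y) - ((K x).starProjection - (K y).starProjection) h‖ := by
          rw [dist_eq_norm, sub_apply]; congr 1; abel
      _ ≤ ‖x - y‖ + ‖((K x).starProjection - (K y).starProjection) h‖ := norm_sub_le _ _
      _ ≤ dist x y + L * dist x y * R := by
          rw [dist_eq_norm]
          refine add_le_add le_rfl ((ContinuousLinearMap.le_opNorm _ _).trans ?_)
          rw [dist_eq_norm] at h1
          exact mul_le_mul h1 hh.le (norm_nonneg _) (by positivity)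
      _ = _ := by
          push_cast
          rw [Real.coe_toNNReal _ hR.le]
          ring
  · intro x hx
    simp [hK.invariant x (hsub hx) _ (Submodule.starProjection_apply_mem _ h)
      (mapsTo_ball hh hx)]

theorem aemeasurable_translate (hK : IsParallelField K L (Metric.ball x₀ (2 * R))) (hR : 0 < R)
    (h : Euc l) : AEMeasurable (fun x => x + (K x).starProjection h)
      (volume.restrict (Metric.ball x₀ R)) :=
  ((hK.continuousOn h).mono (Metric.ball_subset_ball (by linarith))).aemeasurable
    Metric.isOpen_ball.measurableSet

/-- Almost everywhere properties can be transported by the translations along a parallel field. -/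
theorem ae_translate (hK : IsParallelField K L (Metric.ball x₀ (2 * R))) {h : Euc l}
    (hh : ‖h‖ < R) {p : Euc l → Prop} (hp : ∀ᵐ y ∂volume.restrict (Metric.ball x₀ (2 * R)), p y) :
    ∀ᵐ x ∂volume.restrict (Metric.ball x₀ R), p (x + (K x).starProjection h) := by
  have hR : 0 < R := (norm_nonneg h).trans_lt hh
  refine ae_of_ae_map (hK.aemeasurable_translate hR h) ?_
  exact (Measure.absolutelyContinuous_of_le (hK.map_restrict_le hh)).trans
    Measure.smul_absolutelyContinuous hp

/-- The increment of a `C¹` function along a parallel field is controlled by its derivative in the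
directions of the field. -/
theorem lintegral_translate_sub_le (hK : IsParallelField K L (Metric.ball x₀ (2 * R)))
    {h : Euc l} (hh : ‖h‖ < R) {v : Euc l → ℝ} (hv : ContDiff ℝ 1 v) :
    ∫⁻ x in Metric.ball x₀ R, ‖v (x + (K x).starProjection h) - v x‖ₑ ≤
      ‖h‖ₑ * ((1 + L * R.toNNReal : NNReal) : ENNReal) ^ l *
        ∫⁻ y in Metric.ball x₀ (2 * R), ‖(fderiv ℝ v y).comp (K y).starProjection‖ₑ := by
  have hR : 0 < R := (norm_nonneg h).trans_lt hh
  have hsub : Metric.ball x₀ R ⊆ Metric.ball x₀ (2 * R) := Metric.ball_subset_ball (by linarith)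
  set G : Euc l → ENNReal := fun y => ‖(fderiv ℝ v y).comp (K y).starProjection‖ₑ with hG
  set T : Euc l → ℝ → Euc l := fun x t => x + (K x).starProjection (t • h) with hT
  have hth : ∀ t ∈ Icc (0 : ℝ) 1, ‖t • h‖ < R := fun t ht => by
    rw [norm_smul, Real.norm_of_nonneg ht.1]
    exact (mul_le_of_le_one_left (norm_nonneg _) ht.2).trans_lt hh
  have hGc : ContinuousOn G (Metric.ball x₀ (2 * R)) :=
    ((hv.continuous_fderiv one_ne_zero).continuousOn.clm_comp hK.lipschitz.continuousOn).enorm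
  -- The fundamental theorem of calculus along the segment. The field is constant on it, so the
  -- direction of motion belongs to the field at each of its points.
  have hpt : ∀ x ∈ Metric.ball x₀ R, ‖v (x + (K x).starProjection h) - v x‖ₑ ≤
      ∫⁻ t in Icc (0 : ℝ) 1, ‖h‖ₑ * G (T x t) := by
    intro x hx
    have hder : ∀ t : ℝ, HasDerivAt (fun t => v (T x t))
        (fderiv ℝ v (T x t) ((K x).starProjection h)) t := fun t => by
      have h1 : HasDerivAt (T x) ((K x).starProjection h) t := by
        simpa [hT] using
          ((hasDerivAt_id t).smul_const ((K x).starProjection h)).const_add x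
      exact ((hv.differentiable one_ne_zero) _).hasFDerivAt.comp_hasDerivAt t h1
    have hTc : Continuous (T x) := by simp only [hT]; fun_prop
    have hcont : Continuous (fun t => fderiv ℝ v (T x t) ((K x).starProjection h)) :=
      ((hv.continuous_fderiv one_ne_zero).comp hTc).clm_apply continuous_const
    have hFTC := intervalIntegral.integral_eq_sub_of_hasDerivAt (a := 0) (b := 1)
      (fun t _ => hder t) (hcont.intervalIntegrable _ _)
    have hend : v (x + (K x).starProjection h) - v x = v (T x 1) - v (T x 0) := by simp [hT]
    rw [hend, ← hFTC, intervalIntegral.integral_of_le zero_le_one,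
      ← integral_Icc_eq_integral_Ioc]
    refine (enorm_integral_le_lintegral_enorm _).trans ?_
    refine setLIntegral_mono' measurableSet_Icc fun t ht => ?_
    have hKT : K (T x t) = K x := hK.invariant x (hsub hx) _
      (Submodule.starProjection_apply_mem _ _) (mapsTo_ball (hth t ht) hx)
    have : fderiv ℝ v (T x t) ((K x).starProjection h) =
        ((fderiv ℝ v (T x t)).comp (K (T x t)).starProjection) h := by rw [hKT]; rfl
    rw [this, mul_comm]
    exact ContinuousLinearMap.le_opENorm _ _
  have hjoint : AEMeasurable (Function.uncurry fun x t => ‖h‖ₑ * G (T x t))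
      ((volume.restrict (Metric.ball x₀ R)).prod (volume.restrict (Icc (0 : ℝ) 1))) := by
    rw [Measure.prod_restrict]
    refine AEMeasurable.const_mul ?_ _
    refine ContinuousOn.aemeasurable ?_ (Metric.isOpen_ball.measurableSet.prod measurableSet_Icc)
    refine hGc.comp (t := Metric.ball x₀ (2 * R)) (f := fun z : Euc l × ℝ => T z.1 z.2) ?_ ?_
    · refine continuousOn_fst.add (ContinuousOn.clm_apply ?_ ?_)
      · exact hK.lipschitz.continuousOn.comp continuousOn_fst fun z hz => hsub hz.1
      · exact (continuous_snd.smul continuous_const).continuousOn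
    · exact fun z hz => mapsTo_ball (hth z.2 hz.2) hz.1
  calc _ ≤ ∫⁻ x in Metric.ball x₀ R, ∫⁻ t in Icc (0 : ℝ) 1, ‖h‖ₑ * G (T x t) :=
        setLIntegral_mono' Metric.isOpen_ball.measurableSet hpt
    _ = ∫⁻ t in Icc (0 : ℝ) 1, ∫⁻ x in Metric.ball x₀ R, ‖h‖ₑ * G (T x t) :=
        lintegral_lintegral_swap hjoint
    _ ≤ ∫⁻ _ in Icc (0 : ℝ) 1, ‖h‖ₑ * ((1 + L * R.toNNReal : NNReal) : ENNReal) ^ l *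
        ∫⁻ y in Metric.ball x₀ (2 * R), G y := by
      refine setLIntegral_mono' measurableSet_Icc fun t ht => ?_
      rw [lintegral_const_mul' _ _ enorm_ne_top, mul_assoc]
      gcongr
      -- For fixed `t` the points `T x t` are translates by `t • h`, so the volume bound applies
      -- uniformly in `t`.
      have hle := hK.map_restrict_le (hth t ht)
      have hGm : AEMeasurable G ((volume.restrict (Metric.ball x₀ R)).map (fun x => T x t)) :=
        ((hGc.aemeasurable Metric.isOpen_ball.measurableSet).smul_measure _).mono_measure hle
      rw [← lintegral_map' hGm (hK.aemeasurable_translate hR _)]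
      refine (lintegral_mono' hle le_rfl).trans ?_
      rw [lintegral_smul_measure, smul_eq_mul]
    _ = _ := by simp

end IsParallelField

/-! ### Mollification and invariance of Sobolev functions -/

/-- The derivative of the mollification of a Sobolev function is the mollification of the weak
gradient. -/
theorem HasWeakGradientOn.fderiv_convolution_apply {l : ℕ} {Ω C : Set (Euc l)} {w : Euc l → ℝ}
    {g : Euc l → Euc l} (hw : HasWeakGradientOn Ω w g) (hC : IsCompact C) (hCΩ : C ⊆ Ω)
    (hΩ : MeasurableSet Ω)
    (η : ContDiffBump (0 : Euc l)) {y : Euc l} (hy : Metric.closedBall y η.rOut ⊆ C) (e : Euc l) :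
    fderiv ℝ (convolution (η.normed volume) (C.indicator w) (ContinuousLinearMap.lsmul ℝ ℝ)
      volume) y e = ∫ z in Ω, η.normed volume (y - z) * inner ℝ (g z) e := by
  set ρ := η.normed (volume : Measure (Euc l)) with hρ
  have hρs : ContDiff ℝ ∞ ρ := η.contDiff_normed
  have hρ1 : ContDiff ℝ 1 ρ := η.contDiff_normed
  have hρc : HasCompactSupport ρ := η.hasCompactSupport_normed
  have hf : LocallyIntegrable (C.indicator w) := by
    refine Integrable.locallyIntegrable ((integrable_indicator_iff hC.measurableSet).2 ?_)
    exact hw.locallyIntegrable.integrableOn_compact_subset hCΩ hC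
  rw [← convolution_flip]
  rw [(hρc.hasFDerivAt_convolution_right _ hf hρ1 y).fderiv,
    convolution_precompR_apply _ hf (hρc.fderiv ℝ) (hρ1.continuous_fderiv one_ne_zero)]
  -- The sign from differentiating in `z` instead of `y` cancels the sign in the weak gradient.
  have hder : ∀ z, fderiv ℝ (fun z => ρ (y - z)) z e = - fderiv ℝ ρ (y - z) e := fun z => by
    have h1 : HasFDerivAt (fun z => y - z) (-(ContinuousLinearMap.id ℝ (Euc l))) z := by
      simpa using (hasFDerivAt_id z).const_sub y
    have h2 := ((hρ1.differentiable one_ne_zero) (y - z)).hasFDerivAt.comp z h1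
    rw [show (fun z => ρ (y - z)) = ρ ∘ fun z => y - z from rfl, h2.fderiv]
    simp
  have hts : tsupport (fun z => ρ (y - z)) ⊆ C := by
    refine (closure_minimal ?_ Metric.isClosed_closedBall).trans hy
    intro z hz
    have : y - z ∈ Function.support ρ := hz
    rw [hρ, η.support_normed_eq, mem_ball_zero_iff] at this
    rw [Metric.mem_closedBall, dist_comm, dist_eq_norm]
    exact this.le
  have hcs : HasCompactSupport (fun z => ρ (y - z)) :=
    HasCompactSupport.of_support_subset_isCompact hC ((subset_tsupport _).trans hts)
  have hweak := hw.integral_eq (fun z => ρ (y - z))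
    (hρs.comp (contDiff_const.sub contDiff_id)) hcs (hts.trans hCΩ) e
  rw [← neg_eq_iff_eq_neg, ← integral_neg] at hweak
  rw [← hweak, ← integral_indicator hΩ]
  refine integral_congr_ae (Eventually.of_forall fun z => ?_)
  simp only [ContinuousLinearMap.flip_apply, ContinuousLinearMap.lsmul_apply, smul_eq_mul]
  by_cases hzC : z ∈ C
  · rw [indicator_of_mem hzC, indicator_of_mem (hCΩ hzC), hder]
    ring
  · rw [indicator_of_notMem hzC]
    have h0 : fderiv ℝ (fun z => ρ (y - z)) z = 0 := by
      by_contra hne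
      exact hzC (hts (support_fderiv_subset ℝ hne))
    by_cases hzΩ : z ∈ Ω
    · rw [indicator_of_mem hzΩ, h0]; simp
    · rw [indicator_of_notMem hzΩ]; simp

/-- If the weak gradient is orthogonal to a Lipschitz field of subspaces, then the derivative of
the mollification along the field is small. -/
theorem HasWeakGradientOn.lintegral_fderiv_convolution_le {l : ℕ} {Ω : Set (Euc l)} {w : Euc l → ℝ}
    {g : Euc l → Euc l} (hw : HasWeakGradientOn Ω w g) (hΩ : MeasurableSet Ω)
    {K : Euc l → Submodule ℝ (Euc l)} {L : NNReal} {x₀ : Euc l} {R : ℝ}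
    (hBΩ : Metric.closedBall x₀ (3 * R) ⊆ Ω)
    (hK : LipschitzOnWith L (fun x => (K x).starProjection) (Metric.ball x₀ (3 * R)))
    (hg : ∀ᵐ x ∂volume.restrict Ω, (K x).starProjection (g x) = 0)
    (η : ContDiffBump (0 : Euc l)) (hη : η.rOut < R) :
    ∫⁻ y in Metric.ball x₀ (2 * R), ‖(fderiv ℝ (convolution (η.normed volume)
        ((Metric.closedBall x₀ (3 * R)).indicator w) (ContinuousLinearMap.lsmul ℝ ℝ) volume) y).comp
        (K y).starProjection‖ₑ ≤
      ENNReal.ofReal (L * η.rOut) * ∫⁻ z in Metric.ball x₀ (3 * R), ‖g z‖ₑ := by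
  set ρ := η.normed (volume : Measure (Euc l)) with hρ
  have hR : 0 < R := η.rOut_pos.trans hη
  have hball : Metric.ball x₀ (2 * R) ⊆ Metric.ball x₀ (3 * R) :=
    Metric.ball_subset_ball (by linarith)
  have hcball : ∀ y ∈ Metric.ball x₀ (2 * R), Metric.closedBall y η.rOut ⊆
      Metric.ball x₀ (3 * R) := fun y hy => by
    refine Metric.closedBall_subset_ball' ?_
    rw [Metric.mem_ball] at hy
    linarith
  -- The commutator estimate: `g z` is orthogonal to `K z`, so only the difference of the
  -- projections at `y` and `z` sees it. On the support of the kernel this difference is at most `L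
  -- * η.rOut`.
  have hpt : ∀ y ∈ Metric.ball x₀ (2 * R), ‖(fderiv ℝ (convolution ρ
      ((Metric.closedBall x₀ (3 * R)).indicator w) (ContinuousLinearMap.lsmul ℝ ℝ) volume) y).comp
      (K y).starProjection‖ₑ ≤ ENNReal.ofReal (L * η.rOut) *
        ∫⁻ z in Metric.ball x₀ (3 * R), ‖ρ (y - z)‖ₑ * ‖g z‖ₑ := by
    intro y hy
    refine ContinuousLinearMap.opENorm_le_bound _ fun e => ?_
    rw [ContinuousLinearMap.comp_apply, hw.fderiv_convolution_apply (isCompact_closedBall _ _) hBΩ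
      hΩ η ((hcball y hy).trans Metric.ball_subset_closedBall)]
    refine (enorm_integral_le_lintegral_enorm _).trans ?_
    have hle : ∀ᵐ z ∂volume.restrict Ω,
        ‖ρ (y - z) * inner ℝ (g z) ((K y).starProjection e)‖ₑ ≤
        (Metric.ball x₀ (3 * R)).indicator (fun z => ENNReal.ofReal (L * η.rOut) * ‖e‖ₑ *
          (‖ρ (y - z)‖ₑ * ‖g z‖ₑ)) z := by
      filter_upwards [hg] with z hz
      by_cases hyz : y - z ∈ Function.support ρ
      · rw [hρ, η.support_normed_eq, mem_ball_zero_iff] at hyz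
        have hzB : z ∈ Metric.ball x₀ (3 * R) := hcball y hy (by
          rw [Metric.mem_closedBall, dist_comm, dist_eq_norm]; exact hyz.le)
        rw [indicator_of_mem hzB]
        have h0 : inner ℝ (g z) ((K z).starProjection e) = 0 := by
          rw [← Submodule.inner_starProjection_left_eq_right, hz, inner_zero_left]
        have h1 : inner ℝ (g z) ((K y).starProjection e) =
            inner ℝ (g z) (((K y).starProjection - (K z).starProjection) e) := by
          rw [sub_apply, inner_sub_right, h0, sub_zero]
        have h2 : ‖inner ℝ (g z) ((K y).starProjection e)‖ ≤ L * η.rOut * ‖e‖ * ‖g z‖ := by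
          rw [h1]
          refine (norm_inner_le_norm _ _).trans ?_
          rw [mul_comm]
          gcongr
          refine (ContinuousLinearMap.le_opNorm _ _).trans ?_
          gcongr
          have h3 := hK.dist_le_mul y (hball hy) z hzB
          rw [dist_eq_norm, dist_eq_norm] at h3
          exact h3.trans (by gcongr)
        rw [enorm_mul, mul_left_comm]
        gcongr
        rw [← ofReal_norm, ← ofReal_norm, ← ofReal_norm (g z), ← ENNReal.ofReal_mul (by
          have := η.rOut_pos; positivity), ← ENNReal.ofReal_mul (by
          have := η.rOut_pos; positivity)]
        exact ENNReal.ofReal_le_ofReal h2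
      · rw [Function.notMem_support.1 hyz]
        simp
    refine (lintegral_mono_ae hle).trans ?_
    refine (setLIntegral_le_lintegral _ _).trans ?_
    rw [lintegral_indicator Metric.isOpen_ball.measurableSet, lintegral_const_mul' _ _
      (ENNReal.mul_ne_top ENNReal.ofReal_ne_top enorm_ne_top)]
    exact le_of_eq (by ring)
  have hgm : AEMeasurable (fun z => ‖g z‖ₑ) (volume.restrict (Metric.ball x₀ (3 * R))) :=
    (hw.locallyIntegrable_grad.aestronglyMeasurable.enorm).mono_measure
      (Measure.restrict_mono (Metric.ball_subset_closedBall.trans hBΩ) le_rfl)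
  have hρc : Continuous ρ := η.continuous_normed
  have hmass : ∀ z, ∫⁻ y, ‖ρ (y - z)‖ₑ = 1 := fun z => by
    rw [lintegral_sub_right_eq_self (fun y => ‖ρ y‖ₑ) z,
      ← ofReal_integral_norm_eq_lintegral_enorm η.integrable_normed]
    simp_rw [Real.norm_of_nonneg (η.nonneg_normed _), η.integral_normed, ENNReal.ofReal_one]
  calc _ ≤ ∫⁻ y in Metric.ball x₀ (2 * R), ENNReal.ofReal (L * η.rOut) *
        ∫⁻ z in Metric.ball x₀ (3 * R), ‖ρ (y - z)‖ₑ * ‖g z‖ₑ :=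
      setLIntegral_mono' Metric.isOpen_ball.measurableSet hpt
    _ ≤ ENNReal.ofReal (L * η.rOut) *
        ∫⁻ y, ∫⁻ z in Metric.ball x₀ (3 * R), ‖ρ (y - z)‖ₑ * ‖g z‖ₑ := by
      rw [lintegral_const_mul' _ _ ENNReal.ofReal_ne_top]
      gcongr
      exact Measure.restrict_le_self
    _ = _ := by
      rw [lintegral_lintegral_swap]
      · congr 1
        refine lintegral_congr fun z => ?_
        rw [lintegral_mul_const' _ _ enorm_ne_top, hmass, one_mul]
      · refine AEMeasurable.mul ?_ (hgm.comp_snd)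
        exact (hρc.comp (continuous_fst.sub continuous_snd)).enorm.measurable.aemeasurable

/-- A Sobolev function whose weak gradient is orthogonal to a parallel field is invariant under the
translations along the field. -/
theorem HasWeakGradientOn.ae_translate_eq {l : ℕ} {Ω : Set (Euc l)} {w : Euc l → ℝ}
    {g : Euc l → Euc l} (hw : HasWeakGradientOn Ω w g) (hΩ : MeasurableSet Ω)
    {K : Euc l → Submodule ℝ (Euc l)} {L : NNReal} {x₀ : Euc l} {R : ℝ}
    (hBΩ : Metric.closedBall x₀ (3 * R) ⊆ Ω)
    (hK : IsParallelField K L (Metric.ball x₀ (3 * R)))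
    (hg : ∀ᵐ x ∂volume.restrict Ω, (K x).starProjection (g x) = 0) {h : Euc l} (hh : ‖h‖ < R) :
    ∀ᵐ x ∂volume.restrict (Metric.ball x₀ R), w (x + (K x).starProjection h) = w x := by
  have hR : 0 < R := (norm_nonneg h).trans_lt hh
  have hsub2 : Metric.ball x₀ (2 * R) ⊆ Metric.ball x₀ (3 * R) :=
    Metric.ball_subset_ball (by linarith)
  have hsub1 : Metric.ball x₀ R ⊆ Metric.ball x₀ (2 * R) := Metric.ball_subset_ball (by linarith)
  have hK2 : IsParallelField K L (Metric.ball x₀ (2 * R)) :=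
    ⟨hK.lipschitz.mono hsub2, fun x hx n hn hxn =>
      hK.invariant x (hsub2 hx) n hn (hsub2 hxn)⟩
  set C := Metric.closedBall x₀ (3 * R) with hC
  -- The radii stay below `R` and tend to zero; the fixed ratio 2 of outer to inner radius gives
  -- convergence of the mollifications almost everywhere.
  let η : ℕ → ContDiffBump (0 : Euc l) := fun n =>
    ⟨R / (n + 2) / 2, R / (n + 2), by positivity, half_lt_self (by positivity)⟩
  have hηR : ∀ n, (η n).rOut < R := fun n => by
    change R / (n + 2) < R
    rw [div_lt_iff₀ (by positivity)]
    nlinarith [(Nat.cast_nonneg n : (0 : ℝ) ≤ n)]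
  have hη0 : Tendsto (fun n => (η n).rOut) atTop (𝓝 0) := by
    change Tendsto (fun n : ℕ => R / ((n : ℝ) + 2)) atTop (𝓝 0)
    exact tendsto_const_nhds.div_atTop
      (tendsto_atTop_add_const_right _ _ tendsto_natCast_atTop_atTop)
  have hfi : Integrable (C.indicator w) :=
    (integrable_indicator_iff Metric.isClosed_closedBall.measurableSet).2
      (hw.locallyIntegrable.integrableOn_compact_subset hBΩ (isCompact_closedBall _ _))
  set v : ℕ → Euc l → ℝ := fun n => convolution ((η n).normed volume) (C.indicator w)
    (ContinuousLinearMap.lsmul ℝ ℝ) volume with hv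
  have hvC : ∀ n, ContDiff ℝ 1 (v n) := fun n =>
    (η n).hasCompactSupport_normed.contDiff_convolution_left _
      (ContDiffBump.contDiff_normed (η n) (n := 1)) hfi.locallyIntegrable
  have hlim : ∀ᵐ y, Tendsto (fun n => v n y) atTop (𝓝 (C.indicator w y)) := by
    refine ContDiffBump.ae_convolution_tendsto_right_of_locallyIntegrable (K := 2) hη0
      (Eventually.of_forall fun n => ?_) hfi.locallyIntegrable
    change R / ((n : ℝ) + 2) ≤ 2 * (R / (n + 2) / 2)
    linarith
  have hlim' : ∀ᵐ y ∂volume.restrict (Metric.ball x₀ (2 * R)),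
      Tendsto (fun n => v n y) atTop (𝓝 (w y)) := by
    filter_upwards [ae_restrict_of_ae hlim, ae_restrict_mem Metric.isOpen_ball.measurableSet]
      with y hy hyB
    rwa [indicator_of_mem (Metric.ball_subset_closedBall (hsub2 hyB))] at hy
  have hconv : ∀ᵐ x ∂volume.restrict (Metric.ball x₀ R),
      Tendsto (fun n => ‖v n (x + (K x).starProjection h) - v n x‖ₑ) atTop
        (𝓝 ‖w (x + (K x).starProjection h) - w x‖ₑ) := by
    filter_upwards [hK2.ae_translate hh hlim', ae_restrict_of_ae_restrict_of_subset hsub1 hlim']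
      with x hx1 hx2
    exact (hx1.sub hx2).enorm
  have hmeas : ∀ n, AEMeasurable (fun x => ‖v n (x + (K x).starProjection h) - v n x‖ₑ)
      (volume.restrict (Metric.ball x₀ R)) := fun n =>
    (((hvC n).continuous.measurable.comp_aemeasurable (hK2.aemeasurable_translate hR h)).sub
      (hvC n).continuous.aemeasurable).enorm
  have hgfin : ∫⁻ z in Metric.ball x₀ (3 * R), ‖g z‖ₑ ≠ ⊤ :=
    ((hw.locallyIntegrable_grad.integrableOn_compact_subset hBΩ (isCompact_closedBall _ _)).mono_set
      Metric.ball_subset_closedBall).2.ne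
  have hbound : ∀ n, ∫⁻ x in Metric.ball x₀ R, ‖v n (x + (K x).starProjection h) - v n x‖ₑ ≤
      ‖h‖ₑ * ((1 + L * R.toNNReal : NNReal) : ENNReal) ^ l *
        (ENNReal.ofReal (L * (η n).rOut) * ∫⁻ z in Metric.ball x₀ (3 * R), ‖g z‖ₑ) := fun n =>
    (hK2.lintegral_translate_sub_le hh (hvC n)).trans (by
      gcongr
      exact hw.lintegral_fderiv_convolution_le hΩ hBΩ hK.lipschitz hg (η n) (hηR n))
  have hto0 : Tendsto (fun n => ‖h‖ₑ * ((1 + L * R.toNNReal : NNReal) : ENNReal) ^ l *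
      (ENNReal.ofReal (L * (η n).rOut) * ∫⁻ z in Metric.ball x₀ (3 * R), ‖g z‖ₑ)) atTop
      (𝓝 0) := by
    have h1 : Tendsto (fun n => ENNReal.ofReal (L * (η n).rOut)) atTop (𝓝 0) := by
      have := ENNReal.tendsto_ofReal (hη0.const_mul (L : ℝ))
      simpa using this
    have h2 := ENNReal.Tendsto.mul_const (b := ∫⁻ z in Metric.ball x₀ (3 * R), ‖g z‖ₑ) h1
      (Or.inr hgfin)
    rw [zero_mul] at h2
    have h3 := ENNReal.Tendsto.const_mul
      (a := ‖h‖ₑ * ((1 + L * R.toNNReal : NNReal) : ENNReal) ^ l) h2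
      (Or.inr (ENNReal.mul_ne_top enorm_ne_top (ENNReal.pow_ne_top ENNReal.coe_ne_top)))
    rwa [mul_zero] at h3
  -- Fatou's lemma: the integrals for the mollifications tend to zero with the radius.
  have hint : ∫⁻ x in Metric.ball x₀ R, ‖w (x + (K x).starProjection h) - w x‖ₑ = 0 := by
    refine le_antisymm ?_ zero_le
    calc _ = ∫⁻ x in Metric.ball x₀ R,
          liminf (fun n => ‖v n (x + (K x).starProjection h) - v n x‖ₑ) atTop :=
          lintegral_congr_ae (hconv.mono fun x hx => hx.liminf_eq.symm)
      _ ≤ _ := lintegral_liminf_le' hmeas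
      _ ≤ liminf (fun n => ‖h‖ₑ * ((1 + L * R.toNNReal : NNReal) : ENNReal) ^ l *
        (ENNReal.ofReal (L * (η n).rOut) * ∫⁻ z in Metric.ball x₀ (3 * R), ‖g z‖ₑ)) atTop :=
          liminf_le_liminf (Eventually.of_forall hbound)
      _ = 0 := hto0.liminf_eq
  have hae := (lintegral_eq_zero_iff' (aemeasurable_of_tendsto_metrizable_ae atTop hmeas hconv)).1
    hint
  filter_upwards [hae] with x hx
  rwa [Pi.zero_apply, enorm_eq_zero, sub_eq_zero] at hx

/-! ### Passage to the limit and exchange of quantifiers -/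

/-- Invariance under the translations along a parallel field is stable under `L²` limits. -/
theorem IsParallelField.ae_translate_eq_of_tendsto {l : ℕ} {K : Euc l → Submodule ℝ (Euc l)}
    {L : NNReal} {x₀ : Euc l} {R : ℝ} (hK : IsParallelField K L (Metric.ball x₀ (2 * R)))
    {h : Euc l} (hh : ‖h‖ < R) {w : ℕ → Euc l → ℝ} {u : Euc l → ℝ}
    (hwm : ∀ m, AEStronglyMeasurable (w m) (volume.restrict (Metric.ball x₀ (2 * R))))
    (hum : AEStronglyMeasurable u (volume.restrict (Metric.ball x₀ (2 * R))))
    (hlim : Tendsto (fun m => eLpNorm (w m - u) 2 (volume.restrict (Metric.ball x₀ (2 * R)))) atTop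
      (𝓝 0))
    (hw : ∀ m, ∀ᵐ x ∂volume.restrict (Metric.ball x₀ R),
      w m (x + (K x).starProjection h) = w m x) :
    ∀ᵐ x ∂volume.restrict (Metric.ball x₀ R), u (x + (K x).starProjection h) = u x := by
  have hR : 0 < R := (norm_nonneg h).trans_lt hh
  obtain ⟨ns, -, hns⟩ :=
    (tendstoInMeasure_of_tendsto_eLpNorm two_ne_zero hwm hum hlim).exists_seq_tendsto_ae
  filter_upwards [hK.ae_translate hh hns, ae_restrict_of_ae_restrict_of_subset
    (Metric.ball_subset_ball (by linarith)) hns, ae_all_iff.2 hw] with x hx1 hx2 hx3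
  refine tendsto_nhds_unique hx1 (hx2.congr fun n => (hx3 _).symm)

/-- If a measurable function is almost everywhere invariant under each small translation along a
parallel field, then almost every point has the same value as almost all of its small
translates. -/
theorem IsParallelField.ae_ae_translate_eq {l : ℕ} {K : Euc l → Submodule ℝ (Euc l)}
    {L : NNReal} {x₀ : Euc l} {R : ℝ} (hK : IsParallelField K L (Metric.ball x₀ (2 * R)))
    (hR : 0 < R) {u : Euc l → ℝ}
    (hum : AEStronglyMeasurable u (volume.restrict (Metric.ball x₀ (2 * R))))
    (hu : ∀ h : Euc l, ‖h‖ < R → ∀ᵐ x ∂volume.restrict (Metric.ball x₀ R),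
      u (x + (K x).starProjection h) = u x) :
    ∀ᵐ x ∂volume.restrict (Metric.ball x₀ R),
      ∀ᵐ h ∂volume.restrict (Metric.ball (0 : Euc l) R), u (x + (K x).starProjection h) = u x := by
  classical
  have hsub : Metric.ball x₀ R ⊆ Metric.ball x₀ (2 * R) := Metric.ball_subset_ball (by linarith)
  have hB := (Metric.isOpen_ball (x := x₀) (ε := R)).measurableSet
  set u' := hum.mk u with hu'
  have hu'm : Measurable u' := hum.stronglyMeasurable_mk.measurable
  have heq : ∀ᵐ y ∂volume.restrict (Metric.ball x₀ (2 * R)), u y = u' y := hum.ae_eq_mk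
  have heq1 := ae_restrict_of_ae_restrict_of_subset hsub heq
  -- a measurable version of the translations
  set T : Euc l × Euc l → Euc l := (Metric.ball x₀ R ×ˢ (univ : Set (Euc l))).piecewise
    (fun z => z.1 + (K z.1).starProjection z.2) (fun _ => 0) with hT
  have hTm : Measurable T := by
    refine ContinuousOn.measurable_piecewise ?_ continuousOn_const (hB.prod MeasurableSet.univ)
    refine continuousOn_fst.add (ContinuousOn.clm_apply ?_ continuousOn_snd)
    exact hK.lipschitz.continuousOn.comp continuousOn_fst fun z hz => hsub hz.1
  have hTx : ∀ x ∈ Metric.ball x₀ R, ∀ h, T (x, h) = x + (K x).starProjection h :=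
    fun x hx h => piecewise_eq_of_mem _ _ _ ⟨hx, mem_univ _⟩
  -- Exchanging "every `h`, a.e. `x`" for "a.e. `x`, a.e. `h`" is Tonelli and needs a jointly
  -- measurable set; hence the measurable versions of `u` and of the translations.
  have hswap : ∀ p : Euc l → Euc l → Prop, MeasurableSet {z : Euc l × Euc l | p z.1 (T z)} →
      (∀ h : Euc l, ‖h‖ < R → ∀ᵐ x ∂volume.restrict (Metric.ball x₀ R),
        p x (x + (K x).starProjection h)) →
      ∀ᵐ x ∂volume.restrict (Metric.ball x₀ R), ∀ᵐ h ∂volume.restrict (Metric.ball (0 : Euc l) R),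
        p x (x + (K x).starProjection h) := by
    intro p hpm hp
    have h1 : ∀ᵐ h ∂volume.restrict (Metric.ball (0 : Euc l) R),
        ∀ᵐ x ∂volume.restrict (Metric.ball x₀ R), p x (T (x, h)) := by
      filter_upwards [ae_restrict_mem Metric.isOpen_ball.measurableSet] with h hh
      filter_upwards [hp h (mem_ball_zero_iff.1 hh), ae_restrict_mem hB] with x hx hxB
      rwa [hTx x hxB]
    filter_upwards [(Measure.ae_ae_comm (p := fun x h => p x (T (x, h))) hpm).2 h1,
      ae_restrict_mem hB] with x hx hxB
    filter_upwards [hx] with h hh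
    rwa [hTx x hxB] at hh
  have h1 := hswap (fun x y => u' y = u' x)
    (measurableSet_eq_fun (hu'm.comp hTm) (hu'm.comp measurable_fst)) fun h hh => by
      filter_upwards [hu h hh, hK.ae_translate hh heq, heq1] with x hx1 hx2 hx3
      rw [← hx2, hx1, hx3]
  -- The translates of a fixed `x` may fill only a null slice, so `u = u'` a.e. says nothing about
  -- them directly. The exchange, applied to a measurable null set, shows that they avoid it for
  -- a.e. `h`.
  set N := toMeasurable (volume.restrict (Metric.ball x₀ (2 * R))) {y | ¬ u y = u' y} with hN
  have hN0 : ∀ᵐ y ∂volume.restrict (Metric.ball x₀ (2 * R)), y ∉ N := by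
    exact measure_eq_zero_iff_ae_notMem.1 (by rw [hN, measure_toMeasurable]; exact heq)
  have h2 := hswap (fun _ y => y ∉ N) (hTm (measurableSet_toMeasurable _ _).compl)
    fun h hh => hK.ae_translate hh hN0
  filter_upwards [h1, h2, heq1] with x hx1 hx2 hx3
  filter_upwards [hx1, hx2] with h hh1 hh2
  have : u (x + (K x).starProjection h) = u' (x + (K x).starProjection h) := by
    by_contra hne
    exact hh2 (subset_toMeasurable _ _ hne)
  rw [this, hh1, hx3]

/-! ### From local constancy to constancy on components -/

/-- A function that is locally constant on a dense subset `G` of `F` is constant on the part of `G`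
in a preconnected subset of `F`. -/
theorem IsPreconnected.exists_eq_const_of_dense {X Y : Type*} [TopologicalSpace X] [Nonempty Y]
    {F G C : Set X}
    {u : X → Y} (hGF : G ⊆ F) (hdense : ∀ y ∈ F, ∀ W ∈ 𝓝 y, (W ∩ G).Nonempty)
    (hloc : ∀ y ∈ F, ∃ W ∈ 𝓝 y, ∀ x ∈ W ∩ G, ∀ x' ∈ W ∩ G, u x = u x')
    (hC : IsPreconnected C) (hCF : C ⊆ F) : ∃ c, ∀ x ∈ C ∩ G, u x = c := by
  -- The nearby value of `u` on `G` extends `u` from `G` to all of `F`. Density makes it unique, so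
  -- the extension is locally constant on `F`.
  have hV : ∀ y ∈ F, ∃ c, ∀ᶠ x in 𝓝 y, x ∈ G → u x = c := fun y hy => by
    obtain ⟨W, hW, hWu⟩ := hloc y hy
    obtain ⟨x, hx⟩ := hdense y hy W hW
    exact ⟨u x, Filter.mem_of_superset hW fun z hz hzG => hWu z ⟨hz, hzG⟩ x hx⟩
  choose! V hV using hV
  have hVG : ∀ x ∈ G, V x = u x := fun x hx => ((hV x (hGF hx)).self_of_nhds hx).symm
  have hVloc : ∀ y ∈ F, ∀ᶠ z in 𝓝 y, z ∈ F → V z = V y := fun y hy => by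
    filter_upwards [(hV y hy).eventually_nhds] with z hz hzF
    obtain ⟨x, hx, hxG⟩ := hdense z hzF _ (hz.and (hV z hzF))
    rw [← hx.1 hxG, ← hx.2 hxG]
  have hconst : IsLocallyConstant (fun y : C => V y) := by
    rw [IsLocallyConstant.iff_eventually_eq]
    intro y
    filter_upwards [continuous_subtype_val.continuousAt.eventually (hVloc y (hCF y.2))] with z hz
    exact hz (hCF z.2)
  have := isPreconnected_iff_preconnectedSpace.1 hC
  rcases C.eq_empty_or_nonempty with rfl | ⟨y, hy⟩
  · exact ⟨Classical.arbitrary Y, by simp⟩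
  · refine ⟨V y, fun x hx => ?_⟩
    rw [← hVG x hx.2]
    exact hconst.apply_eq_of_preconnectedSpace ⟨x, hx.1⟩ ⟨y, hy⟩

/-- If two points differ by a vector of `K` of norm less than `R` and at each of them `u` has the
same value as at almost all translates along `K`, then `u` has the same value at both. -/
theorem eq_of_ae_translate_eq {l : ℕ} {K : Submodule ℝ (Euc l)} {R : ℝ} {u : Euc l → ℝ}
    {x x' : Euc l} (hxx' : x - x' ∈ K) (hd : ‖x - x'‖ < R)
    (hx : ∀ᵐ h ∂volume.restrict (Metric.ball (0 : Euc l) R), u (x + K.starProjection h) = u x)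
    (hx' : ∀ᵐ h ∂volume.restrict (Metric.ball (0 : Euc l) R), u (x' + K.starProjection h) = u x') :
    u x = u x' := by
  have hR : 0 < R := (norm_nonneg _).trans_lt hd
  have hB := (Metric.isOpen_ball (x := (0 : Euc l)) (ε := R)).measurableSet
  rw [ae_restrict_iff' hB] at hx hx'
  -- Since `x - x'` lies in `K`, translating `x'` by `h + (x - x')` gives the same point as
  -- translating `x` by `h`. As `‖x - x'‖ < R`, the admissible `h` form a nonempty open set, where a
  -- common good `h` exists.
  have hx'' := (measurePreserving_add_right (volume : Measure (Euc l))
    (x - x')).quasiMeasurePreserving.ae hx'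
  have hcont : Continuous fun h : Euc l => h + (x - x') := by fun_prop
  obtain ⟨h, ⟨hh1, hh2⟩, hh3, hh4⟩ := (Measure.dense_of_ae (hx.and hx'')).inter_open_nonempty
    (Metric.ball 0 R ∩ (fun h => h + (x - x')) ⁻¹' Metric.ball 0 R)
    (Metric.isOpen_ball.inter (Metric.isOpen_ball.preimage hcont))
    ⟨0, by simpa using hR, by simpa [dist_eq_norm] using hd⟩
  rw [← hh3 hh1, ← hh4 hh2, map_add, Submodule.starProjection_eq_self_iff.2 hxx']
  congr 1
  abel

/-- A ball in an affine subspace of dimension `d` has positive `d`-dimensional measure. -/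
theorem hausdorffMeasure_translate_ball_ne_zero {l : ℕ} (K : Submodule ℝ (Euc l)) (y : Euc l)
    {ρ : ℝ} (hρ : 0 < ρ) :
    μH[(Module.finrank ℝ K : ℝ)] {x | x - y ∈ K ∧ x ∈ Metric.ball y ρ} ≠ 0 := by
  have hiso : Isometry (fun n : K => y + (n : Euc l)) := fun a b => by
    rw [edist_add_left]; rfl
  have himage : (fun n : K => y + (n : Euc l)) '' Metric.ball 0 ρ ⊆
      {x | x - y ∈ K ∧ x ∈ Metric.ball y ρ} := by
    rintro _ ⟨n, hn, rfl⟩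
    rw [mem_ball_zero_iff] at hn
    exact ⟨by simp, by simpa [dist_eq_norm] using hn⟩
  intro h0
  have h1 := measure_mono_null himage h0
  rw [hiso.hausdorffMeasure_image (Or.inl (by positivity))] at h1
  have hH : (μH[(Module.finrank ℝ K : ℝ)] : Measure K).IsAddHaarMeasure :=
    isAddHaarMeasure_hausdorffMeasure
  exact (Metric.measure_ball_pos _ _ hρ).ne' h1

/-! ### Proof of the theorem -/

section Main

variable {l k r s : ℕ} {M U Ω : Set (Euc l)} {φ : Euc l → Euc l} {u : Euc l → ℝ}

theorem IsL2LocLimit.exists_radius (hs : 1 ≤ s) (hφ : IsTubularProjection s M U φ)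
    (hr : 2 ≤ r) (hM : IsEmbeddedSubmanifold k r M) (hΩo : IsOpen Ω) (hΩU : Ω ⊆ U)
    (hu : IsL2LocLimit M φ Ω u) {x₀ : Euc l} (hx₀ : x₀ ∈ Ω) :
    ∃ R > 0, Metric.ball x₀ R ⊆ Ω ∧
      (∀ x ∈ Metric.ball x₀ R, ∀ n ∈ (tangentAt M (φ x))ᗮ, x + n ∈ Metric.ball x₀ R →
        φ (x + n) = φ x) ∧
      ∀ᵐ x ∂volume.restrict (Metric.ball x₀ R), ∀ᵐ h ∂volume.restrict (Metric.ball (0 : Euc l) R),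
        u (x + normalProj M φ x h) = u x := by
  obtain ⟨ρ, hρ, hρU, L, hL, hconst⟩ := hφ.exists_ball hs hr hM (hΩU hx₀)
  obtain ⟨ρ', hρ', hρΩ⟩ := Metric.mem_nhds_iff.1 (hΩo.mem_nhds hx₀)
  -- The closed ball of radius `3 * R` must fit: one `R` for the points, one for the translations,
  -- one for the mollification.
  set R := min ρ ρ' / 4 with hRdef
  have hmin : 0 < min ρ ρ' := lt_min hρ hρ'
  have hR : 0 < R := by positivity
  have h3ρ : 3 * R < ρ := by have := min_le_left ρ ρ'; linarith
  have h3ρ' : 3 * R < ρ' := by have := min_le_right ρ ρ'; linarith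
  have hCΩ : Metric.closedBall x₀ (3 * R) ⊆ Ω :=
    (Metric.closedBall_subset_ball h3ρ').trans hρΩ
  have hB3 : Metric.ball x₀ (3 * R) ⊆ Metric.ball x₀ ρ := Metric.ball_subset_ball h3ρ.le
  have hB1 : Metric.ball x₀ R ⊆ Metric.ball x₀ (3 * R) := Metric.ball_subset_ball (by linarith)
  have hB2 : Metric.ball x₀ (2 * R) ⊆ Metric.ball x₀ (3 * R) :=
    Metric.ball_subset_ball (by linarith)
  have hK : ∀ B ⊆ Metric.ball x₀ ρ, IsParallelField (fun x => (tangentAt M (φ x))ᗮ) L B :=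
    fun B hB => ⟨hL.mono hB, fun x hx n hn hxn => by
      simp only [hconst x (hB hx) n hn (hB hxn)]⟩
  have hmeas : ∀ f : Euc l → ℝ, MemL2Loc Ω f →
      AEStronglyMeasurable f (volume.restrict (Metric.ball x₀ (2 * R))) := fun f hf =>
    (hf _ hCΩ (isCompact_closedBall _ _)).1.mono_measure
      (Measure.restrict_mono (hB2.trans Metric.ball_subset_closedBall) le_rfl)
  obtain ⟨huL, w, hw1, hw2, hw3⟩ := hu
  refine ⟨R, hR, hB1.trans (Metric.ball_subset_closedBall.trans hCΩ),
    fun x hx n hn hxn => hconst x (hB3 (hB1 hx)) n hn (hB3 (hB1 hxn)), ?_⟩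
  refine (hK _ (hB2.trans hB3)).ae_ae_translate_eq hR (hmeas u huL) fun h hh => ?_
  refine (hK _ (hB2.trans hB3)).ae_translate_eq_of_tendsto hh (fun m => hmeas _ (hw1 m).1)
    (hmeas u huL) ?_ fun m => ?_
  · refine tendsto_of_tendsto_of_tendsto_of_le_of_le tendsto_const_nhds
      (hw3 _ hCΩ (isCompact_closedBall _ _)) (fun _ => zero_le) fun m => ?_
    exact eLpNorm_mono_measure _
      (Measure.restrict_mono (hB2.trans Metric.ball_subset_closedBall) le_rfl)
  · obtain ⟨g, hg, hPg⟩ := hw2 m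
    exact hg.ae_translate_eq hΩo.measurableSet hCΩ (hK _ hB3) hPg hh

theorem IsL2LocLimit.exists_const_on_fibres (hk : 1 ≤ k) (hkl : k < l) (hs : 1 ≤ s)
    (hφ : IsTubularProjection s M U φ) (hr : 2 ≤ r) (hM : IsEmbeddedSubmanifold k r M)
    (hΩo : IsOpen Ω) (hΩU : Ω ⊆ U) (hu : IsL2LocLimit M φ Ω u) :
    ∃ Z : Set (Euc l), Z ⊆ M ∧ μH[(k : ℝ)] Z = 0 ∧
      ∀ p ∈ M \ Z, ∃ S : Set (Euc l), S ⊆ {x | x ∈ U ∧ φ x = p} ∧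
        μH[(l : ℝ) - (k : ℝ)] S = 0 ∧
        ∀ x₀ ∈ normalSection φ Ω p, ∃ c : ℝ,
          ∀ x ∈ connectedComponentIn (normalSection φ Ω p) x₀ \ S, u x = c := by
  have hrad := fun x (hx : x ∈ Ω) => hu.exists_radius hs hφ hr hM hΩo hΩU hx
  choose! R hR hRΩ hRφ hRu using hrad
  obtain ⟨I, hIΩ, hI, hcover⟩ := TopologicalSpace.countable_cover_nhdsWithin
    (fun x hx => mem_nhdsWithin_of_mem_nhds (Metric.ball_mem_nhds x (hR x hx)))
  -- the points where `u` does not have the same value as at almost all nearby translates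
  set N : Set (Euc l) := ⋃ i ∈ I, {x | x ∈ Metric.ball i (R i) ∧
    ¬ ∀ᵐ h ∂volume.restrict (Metric.ball (0 : Euc l) (R i)),
      u (x + normalProj M φ x h) = u x} with hN
  have hNnull : volume N = 0 := by
    refine (measure_biUnion_null_iff hI).2 fun i hi => ?_
    have := hRu i (hIΩ hi)
    rw [ae_restrict_iff' Metric.isOpen_ball.measurableSet, ae_iff] at this
    refine measure_mono_null (fun x hx => ?_) this
    exact fun hcon => hx.2 (hcon hx.1)
  have hNU : N ⊆ U := iUnion₂_subset fun i hi x hx => hΩU (hRΩ i (hIΩ hi) hx.1)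
  refine ⟨M ∩ {p | μH[(l : ℝ) - k] (N ∩ φ ⁻¹' {p}) ≠ 0}, inter_subset_left,
    measure_mono_null inter_subset_right
      (hφ.hausdorffMeasure_fibre_eq_zero hk hkl hs (by omega) hM hNU hNnull), ?_⟩
  rintro p ⟨hpM, hpZ⟩
  have hS0 : μH[(l : ℝ) - k] (N ∩ φ ⁻¹' {p}) = 0 := by
    by_contra hne
    exact hpZ ⟨hpM, hne⟩
  have hdim : (Module.finrank ℝ (tangentAt M p)ᗮ : ℝ) = (l : ℝ) - k := by
    have h1 := Submodule.finrank_add_finrank_orthogonal (tangentAt M p)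
    rw [hM.finrank_tangentAt (by omega) hpM, finrank_euclideanSpace_fin] at h1
    rw [eq_sub_iff_add_eq, add_comm]
    exact_mod_cast h1
  refine ⟨N ∩ φ ⁻¹' {p}, fun x hx => ⟨hNU hx.1, hx.2⟩, hS0, fun x₀ _ => ?_⟩
  have hpos : ∀ y ∈ normalSection φ Ω p, ∀ y' ∈ normalSection φ Ω p,
      y - y' ∈ (tangentAt M p)ᗮ := fun y hy y' hy' => by
    have h1 := hφ.orthogonal y (hΩU hy.1)
    have h2 := hφ.orthogonal y' (hΩU hy'.1)
    rw [hy.2] at h1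
    rw [hy'.2] at h2
    simpa using Submodule.sub_mem _ h1 h2
  -- As `φ` is constant along normal directions, a small `(ℓ-k)`-dimensional ball around `y` lies in
  -- the section. It has positive measure and cannot be contained in the null set.
  have hdense : ∀ y ∈ normalSection φ Ω p, ∀ W ∈ 𝓝 y,
      (W ∩ (normalSection φ Ω p \ (N ∩ φ ⁻¹' {p}))).Nonempty := by
    intro y hy W hW
    obtain ⟨i, hi, hyi⟩ := mem_iUnion₂.1 (hcover hy.1)
    obtain ⟨ρ, hρ, hρW⟩ := Metric.mem_nhds_iff.1
      (inter_mem hW (Metric.isOpen_ball.mem_nhds hyi))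
    by_contra hempty
    refine hausdorffMeasure_translate_ball_ne_zero (tangentAt M p)ᗮ y hρ ?_
    rw [hdim]
    refine measure_mono_null (fun x hx => ?_) hS0
    by_contra hxS
    have hxi := (hρW hx.2).2
    have hφx : φ x = p := by
      have := hRφ i (hIΩ hi) y hyi (x - y) (by rw [hy.2]; exact hx.1) (by simpa using hxi)
      rwa [add_sub_cancel, hy.2] at this
    exact hempty ⟨x, (hρW hx.2).1, ⟨hRΩ i (hIΩ hi) hxi, hφx⟩, hxS⟩
  have hloc : ∀ y ∈ normalSection φ Ω p, ∃ W ∈ 𝓝 y,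
      ∀ x ∈ W ∩ (normalSection φ Ω p \ (N ∩ φ ⁻¹' {p})),
      ∀ x' ∈ W ∩ (normalSection φ Ω p \ (N ∩ φ ⁻¹' {p})), u x = u x' := by
    intro y hy
    obtain ⟨i, hi, hyi⟩ := mem_iUnion₂.1 (hcover hy.1)
    -- Radius `R i / 2` around `y` keeps any two points at distance less than `R i`, as a common
    -- translate requires.
    refine ⟨Metric.ball i (R i) ∩ Metric.ball y (R i / 2), inter_mem
      (Metric.isOpen_ball.mem_nhds hyi)
      (Metric.ball_mem_nhds y (half_pos (hR i (hIΩ hi)))), ?_⟩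
    have hgood : ∀ x ∈ Metric.ball i (R i), x ∈ normalSection φ Ω p \ (N ∩ φ ⁻¹' {p}) →
        ∀ᵐ h ∂volume.restrict (Metric.ball (0 : Euc l) (R i)),
          u (x + (tangentAt M p)ᗮ.starProjection h) = u x := by
      intro x hxi hx
      by_contra hcon
      refine hx.2 ⟨mem_iUnion₂.2 ⟨i, hi, hxi, fun hcon' => hcon ?_⟩, hx.1.2⟩
      simpa only [normalProj, hx.1.2] using hcon'
    rintro x ⟨⟨hxi, hxy⟩, hx⟩ x' ⟨⟨hxi', hxy'⟩, hx'⟩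
    refine eq_of_ae_translate_eq (hpos x hx.1 x' hx'.1) ?_ (hgood x hxi hx) (hgood x' hxi' hx')
    rw [← dist_eq_norm]
    calc dist x x' ≤ dist x y + dist x' y := dist_triangle_right _ _ _
      _ < R i / 2 + R i / 2 := add_lt_add hxy hxy'
      _ = R i := by ring
  obtain ⟨c, hc⟩ := IsPreconnected.exists_eq_const_of_dense sdiff_subset hdense hloc
    (isPreconnected_connectedComponentIn (x := x₀)) (connectedComponentIn_subset _ _)
  exact ⟨c, fun x hx => hc x ⟨hx.1, connectedComponentIn_subset _ _ hx.1, hx.2⟩⟩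

theorem MemL2s.isL2LocLimit (hu : MemL2s M φ Ω u) : IsL2LocLimit M φ Ω u := by
  have hloc : ∀ {F : Type} [NormedAddCommGroup F] (f : Euc l → F),
      MemLp f 2 (volume.restrict Ω) → MemL2Loc Ω f := fun f hf C hC _ =>
    hf.mono_measure (Measure.restrict_mono hC le_rfl)
  -- For `m = 0` the tolerance is `⊤`; only the limit matters.
  have hex := fun m : ℕ => hu.2 ((m : ENNReal)⁻¹) (ENNReal.inv_pos.2 (ENNReal.natCast_ne_top m))
  choose w hw hwu using hex
  refine ⟨hloc u hu.1, w, fun m => ⟨hloc _ (hw m).1.1, ?_⟩, fun m => (hw m).2, fun C hC _ => ?_⟩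
  · obtain ⟨g, hg, hwg⟩ := (hw m).1.2
    exact ⟨g, hloc g hg, hwg⟩
  · exact tendsto_of_tendsto_of_tendsto_of_le_of_le tendsto_const_nhds
      ENNReal.tendsto_inv_nat_nhds_zero (fun _ => zero_le) fun m =>
        (eLpNorm_mono_measure _ (Measure.restrict_mono hC le_rfl)).trans (hwu m).le

end Main

theorem theorem3p1 (l k r : ℕ) (hk : 1 ≤ k) (hkl : k < l) (hr : 2 ≤ r)
    (M U : Set (Euc l)) (φ : Euc l → Euc l)
    (hM : IsEmbeddedSubmanifold k r M)
    (hφ : IsTubularProjection (r - 1) M U φ)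
    (Ω : Set (Euc l)) (hΩo : IsOpen Ω) (hΩc : IsConnected Ω)
    (hΩb : Bornology.IsBounded Ω) (hΩU : closure Ω ⊆ U) :
    (∀ u : Euc l → ℝ, IsL2LocLimit M φ Ω u →
      ∃ Z : Set (Euc l), Z ⊆ M ∧ μH[(k : ℝ)] Z = 0 ∧
        ∀ p ∈ M \ Z, ∃ S : Set (Euc l), S ⊆ {x | x ∈ U ∧ φ x = p} ∧
          μH[(l : ℝ) - (k : ℝ)] S = 0 ∧
          ∀ x₀ ∈ normalSection φ Ω p, ∃ c : ℝ,
            ∀ x ∈ connectedComponentIn (normalSection φ Ω p) x₀ \ S, u x = c) ∧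
    (∀ u : Euc l → ℝ, MemL2s M φ Ω u → IsL2LocLimit M φ Ω u) :=
  ⟨fun _ hu => hu.exists_const_on_fibres hk hkl (by omega) hφ hr hM hΩo
    (subset_closure.trans hΩU), fun _ hu => hu.isL2LocLimit⟩
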